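/- **Setting.** Let $\mathcal X$ be a measurable state space, $\mathcal A$ a finite nonempty action set, $\gamma\in[0,1)$, $H=1/(1-\gamma)$, $r:\mathcal X\times\mathcal A\to[-1,1]$ a reward function and $P$ a transition probability kernel from $\mathcal X\times\mathcal A$ to $\mathcal X$. Assume the MDP is linear: there are a known measurable map $\phi:\mathcal X\times\mathcal A\to\mathbb R^d$, a vector $\psi\in\mathbb R^d$ and finite signed measures $\mu_1,\dots,\mu_d$ on $\mathcal X$ with $r=\phi^\top\psi$ and $P(\cdot\mid x,a)=\sum_i\phi_i(x,a)\mu_i$, and $\{\phi(x,a)\}$ is compact and spans $\mathbb R^d$. For a policy (probability kernel) $\pi$ let $q_\pi$ be the unique bounded measurable solution of $q=r+\gamma P\pi q$, where $(\pi q)(x)=\sum_a\pi(a\mid x)q(x,a)$, let $v_\pi=\pi q_\pi$, and let $v_*=\sup_\pi v_\pi$ pointwise (the value function of an optimal policy). Put $u_d=4d\log\log(d+4)+28$. Let $\rho$ be a near-optimal design, as supplied by an optimal-design oracle: a finitely supported probability distribution on $\mathcal X\times\mathcal A$ with support $\mathcal C$, $|\mathcal C|\le u_d$, such that $G=\sum_{z\in\mathcal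 C}\rho(z)\phi(z)\phi(z)^\top$ is invertible and $\phi(z)^\top G^{-1}\phi(z)\le 2d$ for all $z\in\mathcal X\times\mathcal A$. **Algorithm** (WLS-MDVI with weight $f=\mathbf 1$, parameters $\alpha\in[0,1)$ and $K,M\in\mathbb N$). Start with $\bar\theta_0=0\in\mathbb R^d$ and $w_0=w_{-1}=0$. For $k=0,\dots,K-1$: put $v_k=w_k-\alpha w_{k-1}$; for every $z\in\mathcal C$ draw $M$ fresh independent samples $y_{k,1,z},\dots,y_{k,M,z}\sim P(\cdot\mid z)$ from the generative model and set $\hat q_{k+1}(z)=r(z)+\frac{\gamma}{M}\sum_{n=1}^M v_k(y_{k,n,z})$; let $\theta_{k+1}=\operatorname{argmin}_{\theta\in\mathbb R^d}\sum_{z\in\mathcal C}\rho(z)(\phi(z)^\top\theta-\hat q_{k+1}(z))^2$, $\bar\theta_{k+1}=\theta_{k+1}+\alpha\bar\theta_k$ and $w_{k+1}(x)=\max_{a}\phi(x,a)^\top\bar\theta_{k+1}$. The output is $v_K=w_K-\alpha w_{K-1}$. **Theorem (Sample complexity of WLS-MDVI with $f=\mathbf 1$).** Let $6\le c_0\le 8$.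 There are constants $c_3,c_4\ge1$, $C\in\mathbb R$ and $p\in\mathbb N$, independent of $d$, $H$, $\mathcal X$, $\mathcal A$, $\varepsilon$, $\delta$ (and of the MDP and the design), such that for all $\varepsilon\in(0,1/H]$ and $\delta\in(0,1)$ the following holds. Run WLS-MDVI with $\alpha=\gamma$, $f=\mathbf 1$, $$K=\left\lceil\frac{3}{1-\alpha}\log(c_3H)+1\right\rceil,\qquad M=\left\lceil\frac{c_4\,d\,H^2}{\varepsilon}\,\log\frac{2c_0^2\,u_d\,K}{(c_0-5)\,\delta}\right\rceil .$$ Then with probability at least $1-3\delta/c_0$ the output satisfies $$\|v_*-v_K\|_\infty\le\tfrac12\sqrt H ,$$ and the number $|\mathcal C|KM$ of samples drawn from the generative model satisfies $$|\mathcal C|KM\;\le\;u_dKM\;\le\;C\,\frac{d^2H^3}{\varepsilon}\,\bigl(1+\log(1/\delta)\bigr)\bigl(1+\log(dH)\bigr)^p,$$ that is, it is $\widetilde O(u_dKM)=\widetilde O(d^2H^3/\varepsilon)$. -/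

import Mathlib

open MeasureTheory ProbabilityTheory
open scoped Matrix

namespace WLSMDVI

/-- An infinite-horizon discounted MDP with state space `X`, action space `A`, rewards in
`[-1, 1]` and discount factor `γ ∈ [0, 1)`, which is linear in a known feature map `φ` into `ℝ^d`
whose image is compact and spans `ℝ^d`. -/
structure LinearMDP (X A : Type*) [MeasurableSpace X] [MeasurableSpace A] (d : ℕ) where
  /-- discount factor -/
  γ : ℝ
  γ_nonneg : 0 ≤ γ
  γ_lt_one : γ < 1
  /-- reward function -/
  r : X × A → ℝ
  r_bound : ∀ z, r z ∈ Set.Icc (-1 : ℝ) 1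
  /-- transition probability kernel -/
  P : Kernel (X × A) X
  markov : IsMarkovKernel P
  /-- feature map -/
  φ : X × A → (Fin d → ℝ)
  φ_measurable : Measurable φ
  reward_linear : ∃ ψ : Fin d → ℝ, ∀ z, r z = φ z ⬝ᵥ ψ
  transition_linear : ∃ μ : Fin d → SignedMeasure X, ∀ z, ∀ B : Set X, MeasurableSet B →
    (P z).real B = ∑ i, φ z i * μ i B
  compact_features : IsCompact (Set.range φ)
  span_features : Submodule.span ℝ (Set.range φ) = ⊤

attribute [instance] LinearMDP.markov

section ValueFunctions

variable {X A : Type*} [MeasurableSpace X] [MeasurableSpace A] {d : ℕ}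

/-- The effective horizon `H = 1 / (1 - γ)`. -/
noncomputable def LinearMDP.H (m : LinearMDP X A d) : ℝ := 1 / (1 - m.γ)

/-- A policy is a probability kernel over actions conditioned on states. -/
abbrev Policy (X A : Type*) [MeasurableSpace X] [MeasurableSpace A] : Type _ :=
  {π : Kernel X A // IsMarkovKernel π}

/-- `(π q)(x) = ∑ₐ π(a | x) q(x, a)`. -/
noncomputable def Policy.apply (π : Policy X A) (q : X × A → ℝ) (x : X) : ℝ :=
  ∫ a, q (x, a) ∂(π.1 x)

/-- The Bellman operator `T_π q = r + γ P π q`. -/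
noncomputable def LinearMDP.bellman (m : LinearMDP X A d) (π : Policy X A) (q : X × A → ℝ)
    (z : X × A) : ℝ :=
  m.r z + m.γ * ∫ y, π.apply q y ∂(m.P z)

/-- `q` is a bounded measurable fixed point of the Bellman operator of `π`. -/
def LinearMDP.IsActionValue (m : LinearMDP X A d) (π : Policy X A) (q : X × A → ℝ) : Prop :=
  Measurable q ∧ (∃ B : ℝ, ∀ z, |q z| ≤ B) ∧ ∀ z, m.bellman π q z = q z

theorem LinearMDP.r_measurable (m : LinearMDP X A d) : Measurable m.r := by
  obtain ⟨ψ, hψ⟩ := m.reward_linear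
  have : m.r = fun z => ∑ i, m.φ z i * ψ i := by
    funext z
    rw [hψ z]
    rfl
  rw [this]
  have h := m.φ_measurable
  exact Finset.measurable_sum _ fun i _ => ((measurable_pi_apply i).comp h).mul_const _

theorem Policy.apply_measurable (π : Policy X A) {q : X × A → ℝ} (hq : Measurable q) :
    Measurable (π.apply q) := by
  have := π.2
  exact (hq.stronglyMeasurable.integral_kernel_prod_right' (κ := π.1)).measurable

theorem integrable_of_bound {Y : Type*} [MeasurableSpace Y] (μ : Measure Y)
    [IsProbabilityMeasure μ] {v : Y → ℝ} (hv : Measurable v) {B : ℝ} (hB : ∀ y, |v y| ≤ B) :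
    Integrable v μ :=
  Integrable.of_bound hv.aestronglyMeasurable B (Filter.Eventually.of_forall hB)

theorem abs_integral_le_of_bound {Y : Type*} [MeasurableSpace Y] (μ : Measure Y)
    [IsProbabilityMeasure μ] {v : Y → ℝ} {B : ℝ} (hB : ∀ y, |v y| ≤ B) :
    |∫ y, v y ∂μ| ≤ B := by
  have := norm_integral_le_of_norm_le_const (μ := μ) (f := v) (C := B)
    (Filter.Eventually.of_forall hB)
  simpa using this

theorem LinearMDP.bellman_measurable (m : LinearMDP X A d) (π : Policy X A) {q : X × A → ℝ}
    (hq : Measurable q) : Measurable (m.bellman π q) := by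
  have h1 : Measurable fun z => ∫ y, π.apply q y ∂(m.P z) :=
    (((π.apply_measurable hq).comp measurable_snd).stronglyMeasurable.integral_kernel_prod_right'
      (κ := m.P)).measurable
  exact m.r_measurable.add (h1.const_mul _)

/-- The Bellman operator contracts the supremum distance by the factor `γ`. -/
theorem LinearMDP.bellman_contract (m : LinearMDP X A d) (π : Policy X A) {q q' : X × A → ℝ}
    (hq : Measurable q) (hq' : Measurable q') {B B' : ℝ} (hB : ∀ z, |q z| ≤ B)
    (hB' : ∀ z, |q' z| ≤ B') {D : ℝ} (hD : ∀ z, |q z - q' z| ≤ D) (z : X × A) :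
    |m.bellman π q z - m.bellman π q' z| ≤ m.γ * D := by
  have := π.2
  have e1 : ∀ x, |π.apply q x| ≤ B := fun x => abs_integral_le_of_bound _ fun a => hB (x, a)
  have e2 : ∀ x, |π.apply q' x| ≤ B' := fun x => abs_integral_le_of_bound _ fun a => hB' (x, a)
  have e3 : ∀ x, |π.apply q x - π.apply q' x| ≤ D := by
    intro x
    have i1 : Integrable (fun a => q (x, a)) (π.1 x) :=
      integrable_of_bound _ (hq.comp measurable_prodMk_left) fun a => hB (x, a)
    have i2 : Integrable (fun a => q' (x, a)) (π.1 x) :=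
      integrable_of_bound _ (hq'.comp measurable_prodMk_left) fun a => hB' (x, a)
    unfold Policy.apply
    rw [← integral_sub i1 i2]
    exact abs_integral_le_of_bound _ fun a => hD (x, a)
  have e4 : m.bellman π q z - m.bellman π q' z
      = m.γ * ∫ y, (π.apply q y - π.apply q' y) ∂(m.P z) := by
    rw [integral_sub (integrable_of_bound _ (π.apply_measurable hq) e1)
      (integrable_of_bound _ (π.apply_measurable hq') e2)]
    unfold LinearMDP.bellman
    ring
  rw [e4, abs_mul, abs_of_nonneg m.γ_nonneg]
  exact mul_le_mul_of_nonneg_left (abs_integral_le_of_bound _ e3) m.γ_nonneg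

/-- The Bellman operator of a policy has exactly one bounded measurable fixed point. -/
theorem LinearMDP.existsUnique_actionValue (m : LinearMDP X A d) (π : Policy X A) :
    ∃! q : X × A → ℝ, m.IsActionValue π q := by
  have g0 := m.γ_nonneg
  have g1 := m.γ_lt_one
  have := π.2
  have hpos : 0 < 1 - m.γ := by linarith
  set u : ℕ → X × A → ℝ := fun n => (m.bellman π)^[n] (fun _ => 0) with hu
  have us : ∀ n, u (n + 1) = m.bellman π (u n) := fun n => by
    simp only [hu, Function.iterate_succ_apply']
  have um : ∀ n, Measurable (u n) := by
    intro n
    induction n with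
    | zero => exact measurable_const
    | succ n ih => rw [us]; exact m.bellman_measurable π ih
  have ub : ∀ n z, |u n z| ≤ 1 / (1 - m.γ) := by
    intro n
    induction n with
    | zero => intro z; simp only [hu, Function.iterate_zero, id, abs_zero]; positivity
    | succ n ih =>
      intro z
      rw [us]
      have h1 : |∫ y, π.apply (u n) y ∂(m.P z)| ≤ 1 / (1 - m.γ) :=
        abs_integral_le_of_bound _ fun y => abs_integral_le_of_bound _ fun a => ih (y, a)
      have h2 : |m.r z| ≤ 1 := abs_le.2 (m.r_bound z)
      have h3 : 1 + m.γ * (1 / (1 - m.γ)) = 1 / (1 - m.γ) := by field_simp; ring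
      calc |m.bellman π (u n) z| ≤ |m.r z| + |m.γ * ∫ y, π.apply (u n) y ∂(m.P z)| :=
            abs_add_le _ _
        _ ≤ 1 + m.γ * (1 / (1 - m.γ)) := by
            rw [abs_mul, abs_of_nonneg g0]
            gcongr
        _ = _ := h3
  have ud : ∀ n z, |u n z - u (n + 1) z| ≤ 1 * m.γ ^ n := by
    intro n
    induction n with
    | zero =>
      intro z
      have h2 : |m.r z| ≤ 1 := abs_le.2 (m.r_bound z)
      rw [us]
      simpa [hu, LinearMDP.bellman, Policy.apply] using h2
    | succ n ih =>
      intro z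
      rw [us n, us (n + 1)]
      refine (m.bellman_contract π (um _) (um _) (ub _) (ub _) ih z).trans_eq ?_
      ring
  have uc : ∀ z, CauchySeq fun n => u n z := fun z =>
    cauchySeq_of_le_geometric _ _ g1 fun n => by rw [Real.dist_eq]; exact ud n z
  choose q hq using fun z => cauchySeq_tendsto_of_complete (uc z)
  have qm : Measurable q := measurable_of_tendsto_metrizable um (tendsto_pi_nhds.2 hq)
  have qb : ∀ z, |q z| ≤ 1 / (1 - m.γ) := fun z =>
    le_of_tendsto (hq z).abs (Filter.Eventually.of_forall fun n => ub n z)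
  have qd : ∀ n z, |u n z - q z| ≤ 1 * m.γ ^ n / (1 - m.γ) := by
    intro n z
    have := dist_le_of_le_geometric_of_tendsto (f := fun n => u n z) _ _ g1
      (fun n => by rw [Real.dist_eq]; exact ud n z) (hq z) n
    rwa [Real.dist_eq] at this
  have pow0 : Filter.Tendsto (fun n : ℕ => m.γ ^ n) Filter.atTop (nhds 0) :=
    tendsto_pow_atTop_nhds_zero_of_lt_one g0 g1
  have qfix : ∀ z, m.bellman π q z = q z := by
    intro z
    have t1 : Filter.Tendsto (fun n => u (n + 1) z) Filter.atTop (nhds (q z)) :=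
      (hq z).comp (Filter.tendsto_add_atTop_nat 1)
    have t2 : Filter.Tendsto (fun n => u (n + 1) z) Filter.atTop (nhds (m.bellman π q z)) := by
      rw [tendsto_iff_dist_tendsto_zero]
      have t3 : Filter.Tendsto (fun n : ℕ => m.γ * (1 * m.γ ^ n / (1 - m.γ)))
          Filter.atTop (nhds 0) := by
        have := ((pow0.const_mul 1).div_const (1 - m.γ)).const_mul m.γ
        simpa using this
      refine squeeze_zero (fun _ => dist_nonneg) (fun n => ?_) t3
      rw [Real.dist_eq, us]
      exact m.bellman_contract π (um n) qm (ub n) qb (qd n) z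
    exact tendsto_nhds_unique t2 t1
  refine ⟨q, ⟨qm, ⟨_, qb⟩, qfix⟩, ?_⟩
  rintro q' ⟨qm', ⟨B', qb'⟩, qfix'⟩
  have key : ∀ n : ℕ, ∀ z, |q' z - q z| ≤ m.γ ^ n * (B' + 1 / (1 - m.γ)) := by
    intro n
    induction n with
    | zero =>
      intro z
      have h := abs_sub (q' z) (q z)
      have := qb z
      have := qb' z
      rw [pow_zero, one_mul]
      linarith
    | succ n ih =>
      intro z
      have h := m.bellman_contract π qm' qm qb' qb ih z
      rw [qfix, qfix'] at h
      refine h.trans_eq ?_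
      ring
  funext z
  have t : Filter.Tendsto (fun n : ℕ => m.γ ^ n * (B' + 1 / (1 - m.γ)))
      Filter.atTop (nhds 0) := by
    simpa using pow0.mul_const (B' + 1 / (1 - m.γ))
  have h0 : |q' z - q z| ≤ 0 := ge_of_tendsto' t fun n => key n z
  exact sub_eq_zero.1 (abs_nonpos_iff.1 h0)

/-- `q_π`, the unique fixed point of the Bellman operator of `π`. -/
noncomputable def LinearMDP.actionValue (m : LinearMDP X A d) (π : Policy X A) : X × A → ℝ :=
  Classical.choose (m.existsUnique_actionValue π).exists

/-- `v_π = π q_π`. -/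
noncomputable def LinearMDP.stateValue (m : LinearMDP X A d) (π : Policy X A) : X → ℝ :=
  π.apply (m.actionValue π)

/-- The optimal value function `v_*`: the pointwise supremum of `v_π` over all policies `π`. This
is the value function of any optimal policy. -/
noncomputable def LinearMDP.optimalValue (m : LinearMDP X A d) (x : X) : ℝ :=
  ⨆ π : Policy X A, m.stateValue π x

end ValueFunctions

section Design

variable {X A : Type*} [MeasurableSpace X] [MeasurableSpace A] {d : ℕ}

/-- The bound `4 d log log (d + 4) + 28` on the size of the core set. -/
noncomputable def coreBound (d : ℕ) : ℝ := 4 * d * Real.log (Real.log (d + 4)) + 28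

/-- A design: a finitely supported probability distribution. Its core set is `ρ.support`. -/
structure IsDesign {S : Type*} (ρ : S →₀ ℝ) : Prop where
  nonneg : ∀ z, 0 ≤ ρ z
  sum_eq_one : ∑ z ∈ ρ.support, ρ z = 1

/-- The weighted design matrix `G_f = ∑_{z ∈ C} ρ(z) φ(z) φ(z)ᵀ / f(z)²`. -/
noncomputable def LinearMDP.designMatrix (m : LinearMDP X A d) (f : X × A → ℝ)
    (ρ : (X × A) →₀ ℝ) : Matrix (Fin d) (Fin d) ℝ :=
  ∑ z ∈ ρ.support, (ρ z / f z ^ 2) • Matrix.vecMulVec (m.φ z) (m.φ z)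

/-- What the optimal design oracle returns for the weight `f`: a design whose design matrix is
invertible, with `g_f(ρ) = max_z φ(z)ᵀ G_f⁻¹ φ(z) / f(z)² ≤ 2 d` and a core set of size at most
`4 d log log (d + 4) + 28`. -/
structure LinearMDP.IsWeightedOptimalDesign (m : LinearMDP X A d) (f : X × A → ℝ)
    (ρ : (X × A) →₀ ℝ) : Prop where
  isDesign : IsDesign ρ
  invertible : IsUnit (m.designMatrix f ρ).det
  value_le : ∀ z, (m.φ z ⬝ᵥ (m.designMatrix f ρ)⁻¹ *ᵥ m.φ z) / f z ^ 2 ≤ 2 * d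
  card_le : (ρ.support.card : ℝ) ≤ coreBound d

/-- The weighted squared loss of the parameter `θ` for the regression targets `q` on the core
set. -/
noncomputable def LinearMDP.loss (m : LinearMDP X A d) (f : X × A → ℝ) (ρ : (X × A) →₀ ℝ)
    (q : ρ.support → ℝ) (θ : Fin d → ℝ) : ℝ :=
  ∑ z : ρ.support, ρ z / f z ^ 2 * (m.φ z ⬝ᵥ θ - q z) ^ 2

/-- The weighted least-squares parameter: a minimizer of the loss. -/
noncomputable def LinearMDP.leastSquares (m : LinearMDP X A d) (f : X × A → ℝ)
    (ρ : (X × A) →₀ ℝ) (q : ρ.support → ℝ) : Fin d → ℝ :=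
  Classical.epsilon fun θ => ∀ θ', m.loss f ρ q θ ≤ m.loss f ρ q θ'

/-- The minimizer of the loss exists and is unique when the design matrix is invertible. -/
theorem LinearMDP.existsUnique_leastSquares (m : LinearMDP X A d) (f : X × A → ℝ)
    (ρ : (X × A) →₀ ℝ) (hρ : IsDesign ρ) (hG : IsUnit (m.designMatrix f ρ).det)
    (q : ρ.support → ℝ) :
    ∃! θ : Fin d → ℝ, ∀ θ', m.loss f ρ q θ ≤ m.loss f ρ q θ' := by
  set c : ρ.support → ℝ := fun z => ρ z / f z ^ 2 with hc
  have c0 : ∀ z, 0 ≤ c z := fun z => div_nonneg (hρ.nonneg _) (sq_nonneg _)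
  have Gmul : ∀ t, m.designMatrix f ρ *ᵥ t = ∑ z : ρ.support, (c z * (m.φ z ⬝ᵥ t)) • m.φ z := by
    intro t
    unfold LinearMDP.designMatrix
    rw [← Finset.sum_coe_sort, Matrix.sum_mulVec]
    refine Finset.sum_congr rfl fun z _ => ?_
    rw [Matrix.smul_mulVec, Matrix.vecMulVec_mulVec]
    ext i
    simp [hc, mul_assoc, mul_comm, mul_left_comm]
  set b : Fin d → ℝ := ∑ z : ρ.support, (c z * q z) • m.φ z with hb
  set t0 := (m.designMatrix f ρ)⁻¹ *ᵥ b with ht0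
  have hGt0 : m.designMatrix f ρ *ᵥ t0 = b := by
    rw [ht0, Matrix.mulVec_mulVec, Matrix.mul_nonsing_inv _ hG, Matrix.one_mulVec]
  have expand : ∀ t, m.loss f ρ q t
      = m.loss f ρ q t0 + ∑ z : ρ.support, c z * (m.φ z ⬝ᵥ (t - t0)) ^ 2 := by
    intro t
    have cross : ∑ z : ρ.support, c z * (m.φ z ⬝ᵥ t0 - q z) * (m.φ z ⬝ᵥ (t - t0)) = 0 := by
      have h1 : (∑ z : ρ.support, (c z * (m.φ z ⬝ᵥ t0) - c z * q z) • m.φ z) = 0 := by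
        simp only [sub_smul, Finset.sum_sub_distrib]
        rw [← Gmul, hGt0, hb, sub_self]
      have h2 := congrArg (fun v => v ⬝ᵥ (t - t0)) h1
      simp only [sum_dotProduct, smul_dotProduct, zero_dotProduct, smul_eq_mul] at h2
      rw [← h2]
      exact Finset.sum_congr rfl fun z _ => by ring
    have h3 : m.loss f ρ q t = m.loss f ρ q t0
        + ∑ z : ρ.support, c z * (m.φ z ⬝ᵥ (t - t0)) ^ 2
        + 2 * ∑ z : ρ.support, c z * (m.φ z ⬝ᵥ t0 - q z) * (m.φ z ⬝ᵥ (t - t0)) := by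
      unfold LinearMDP.loss
      rw [Finset.mul_sum, ← Finset.sum_add_distrib, ← Finset.sum_add_distrib]
      refine Finset.sum_congr rfl fun z _ => ?_
      rw [dotProduct_sub]
      simp only [hc]
      ring
    rw [h3, cross, mul_zero, add_zero]
  have nn : ∀ t, 0 ≤ ∑ z : ρ.support, c z * (m.φ z ⬝ᵥ (t - t0)) ^ 2 := fun t =>
    Finset.sum_nonneg fun z _ => mul_nonneg (c0 z) (sq_nonneg _)
  refine ⟨t0, fun t => by rw [expand t]; linarith [nn t], ?_⟩
  intro t ht
  have h1 : ∑ z : ρ.support, c z * (m.φ z ⬝ᵥ (t - t0)) ^ 2 = 0 := by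
    have := ht t0
    rw [expand t] at this
    linarith [nn t]
  have h2 := (Finset.sum_eq_zero_iff_of_nonneg
    (fun z _ => mul_nonneg (c0 z) (sq_nonneg _))).1 h1
  have h3 : m.designMatrix f ρ *ᵥ (t - t0) = 0 := by
    rw [Gmul]
    refine Finset.sum_eq_zero fun z hz => ?_
    rcases mul_eq_zero.1 (h2 z hz) with h | h
    · rw [h]; simp
    · rw [pow_eq_zero_iff two_ne_zero] at h
      rw [h]; simp
  have h4 := congrArg (fun v => (m.designMatrix f ρ)⁻¹ *ᵥ v) h3
  simp only [Matrix.mulVec_mulVec, Matrix.nonsing_inv_mul _ hG, Matrix.one_mulVec,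
    Matrix.mulVec_zero] at h4
  exact sub_eq_zero.1 h4

end Design

section Algorithm

variable {X A : Type*} [MeasurableSpace X] [MeasurableSpace A] {d : ℕ}

/-- The variables kept by the main loop at step `k`: the averaged parameter, and the functions
`w_k` and `w_{k-1}`. -/
structure LoopState (X : Type*) (d : ℕ) where
  thetaBar : Fin d → ℝ
  w : X → ℝ
  wPrev : X → ℝ

/-- `v_k = w_k - α w_{k-1}`. -/
def LoopState.v (α : ℝ) (st : LoopState X d) (x : X) : ℝ := st.w x - α * st.wPrev x

/-- All parameters and functions start at zero. -/
def initialState (X : Type*) (d : ℕ) : LoopState X d := ⟨0, 0, 0⟩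

/-- The regression targets `q̂(z) = r(z) + γ M⁻¹ ∑ₙ v(y_{n,z})` on the core set `C`, computed from
`M` next states `y_{n,z}` for each `z ∈ C`. -/
noncomputable def LinearMDP.target (m : LinearMDP X A d) {M : ℕ} {C : Finset (X × A)}
    (v : X → ℝ) (batch : Fin M → C → X) (z : C) : ℝ :=
  m.r z + m.γ * ((1 / (M : ℝ)) * ∑ n, v (batch n z))

/-- One pass of the main loop, which uses one batch of `M` next states per core set element. -/
noncomputable def LinearMDP.step (m : LinearMDP X A d) [Fintype A] [Nonempty A] (α : ℝ)
    (f : X × A → ℝ) (ρ : (X × A) →₀ ℝ) {M : ℕ} (batch : Fin M → ρ.support → X)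
    (st : LoopState X d) : LoopState X d :=
  let θ := m.leastSquares f ρ (m.target (st.v α) batch)
  let θbar := θ + α • st.thetaBar
  ⟨θbar, fun x => Finset.univ.sup' Finset.univ_nonempty fun a => m.φ (x, a) ⬝ᵥ θbar, st.w⟩

/-- The state after `K` passes of the main loop on `K` batches of samples. -/
noncomputable def LinearMDP.run (m : LinearMDP X A d) [Fintype A] [Nonempty A] (α : ℝ)
    (f : X × A → ℝ) (ρ : (X × A) →₀ ℝ) (M : ℕ) :
    (K : ℕ) → (Fin K → Fin M → ρ.support → X) → LoopState X d
  | 0, _ => initialState X d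
  | K + 1, y => m.step α f ρ (y (Fin.last K)) (run m α f ρ M K fun k => y k.castSucc)

/-- The calls to the generative model: one for each iteration, each repetition and each element of
the core set. -/
abbrev Call (K M : ℕ) (C : Finset (X × A)) : Type _ := Fin K × Fin M × C

/-- The output `v_K` of WLS-MDVI, as a function of the answers of the generative model. -/
noncomputable def LinearMDP.wlsMDVI (m : LinearMDP X A d) [Fintype A] [Nonempty A] (α : ℝ)
    (f : X × A → ℝ) (ρ : (X × A) →₀ ℝ) (K M : ℕ) (y : Call K M ρ.support → X) : X → ℝ :=
  (m.run α f ρ M K fun k n z => y (k, n, z)).v α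

/-- The joint law of the answers of the generative model: independent samples, where a call at
`z` is answered by a sample from `P(· | z)`. -/
noncomputable def LinearMDP.sampleLaw (m : LinearMDP X A d) (K M : ℕ) (C : Finset (X × A)) :
    Measure (Call K M C → X) :=
  Measure.pi fun i => m.P i.2.2

/-- The number of samples drawn from the generative model by WLS-MDVI. -/
def sampleCount (K M : ℕ) (C : Finset (X × A)) : ℕ := Fintype.card (Call K M C)

/-- `K = ⌈3 / (1 - α) * log (c₃ H) + 1⌉`. -/
noncomputable def numIterations (c₃ α H : ℝ) : ℕ := ⌈3 / (1 - α) * Real.log (c₃ * H) + 1⌉₊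

/-- `M = ⌈c₄ d H² / ε * log (2 c₀² u K / ((c₀ - 5) δ))⌉` with `u = 4 d log log (d + 4) + 28`. -/
noncomputable def numRepetitions (c₀ c₄ : ℝ) (d : ℕ) (H ε δ : ℝ) (K : ℕ) : ℕ :=
  ⌈c₄ * d * H ^ 2 / ε * Real.log (2 * c₀ ^ 2 * coreBound d * K / ((c₀ - 5) * δ))⌉₊

end Algorithm

end WLSMDVI

/-!
The sample size `M` is of order `d H² / ε ≥ d H³`, and the claimed accuracy `√H / 2` is coarse.
At this accuracy the sup-norm errors of the single passes may be added up, so Hoeffding's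
inequality and a union bound over the passes and the core set suffice.

*One pass.* Since the MDP is linear, `r + γ P v = φᵀ θ` for some `θ`
(`exists_lookahead_eq_dotProduct`). If the empirical means of `v_k` are accurate up to `t` on the
core set, the regression reproduces `r + γ P v_k` up to `E = t √(2 d)` everywhere
(`abs_dotProduct_leastSquares_sub_le`).

*Many passes.* Write `s_k = φᵀ θ̄_k`, so that `w_k = max_a s_k`. Three recursions that contract by
`γ`, with `H = 1 / (1 - γ)`, control the output up to terms of order `γ ^ k (H + k)`:
`v_k ≤ v_* + H E`, as `v_{k+1} ≤ (r + γ P v_k) + E` at a greedy action of `s_{k+1}` (`v_le`);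
`w_k / H ≥ v_* - H E`, as the averaged function satisfies
`s_k ≈ H (1 - γ ^ k) r + γ P w_{k-1}` up to `H E`, which is value iteration with rewards that grow
to `H r` (`abs_s_sub_le`, `optimal_le_w`); and `v_{k+1} ≥ w_k / H - 2 H E`, by evaluating both at a
greedy action of `s_k` (`w_le_v_succ`). Hence `|v_* - v_K| ≤ 3 H E + γ ^ (K - 1) (H + 2 K - 1)`
(`abs_optimalValue_sub_le`). With `E = 1 / (12 √H)` the first term is `√H / 4`, and the choice of
`K` makes the second at most `1 / 4`.

*Probability.* The function `v_k` depends only on the batches before batch `k`. With these fixed,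
its truncation to `[-2 H, 2 H]` is a fixed bounded function and Hoeffding's inequality applies
(`measure_badEvent_le`). Outside the bad events `|v_k| ≤ 2 H` holds by induction on `k`, so the
truncation has no effect there (`isApproxIteration_of_notMem_badEvent`).

The supremum over policies is handled by identifying `v_*` with the fixed point of the optimal
Bellman operator (`optimalValue_eq_of_fixedPoint`).
-/

namespace WLSMDVI

/-! ### The optimal value function -/

section MaxAction

variable {X A : Type*}

/-- The maximum over the actions, `x ↦ max_a q (x, a)`. -/
noncomputable def maxAction [Fintype A] [Nonempty A] (q : X × A → ℝ) (x : X) : ℝ :=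
  Finset.univ.sup' Finset.univ_nonempty fun a => q (x, a)

theorem le_maxAction [Fintype A] [Nonempty A] (q : X × A → ℝ) (x : X) (a : A) :
    q (x, a) ≤ maxAction q x :=
  Finset.le_sup' (fun a => q (x, a)) (Finset.mem_univ a)

theorem exists_maxAction_eq [Fintype A] [Nonempty A] (q : X × A → ℝ) (x : X) :
    ∃ a, maxAction q x = q (x, a) := by
  obtain ⟨a, -, ha⟩ := Finset.exists_mem_eq_sup' Finset.univ_nonempty fun a => q (x, a)
  exact ⟨a, ha⟩

theorem abs_maxAction_sub_le [Fintype A] [Nonempty A] {q q' : X × A → ℝ} {D : ℝ}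
    (h : ∀ z, |q z - q' z| ≤ D) (x : X) : |maxAction q x - maxAction q' x| ≤ D := by
  obtain ⟨a, ha⟩ := exists_maxAction_eq q x
  obtain ⟨b, hb⟩ := exists_maxAction_eq q' x
  have h1 := abs_le.1 (h (x, a))
  have h2 := abs_le.1 (h (x, b))
  have h3 := le_maxAction q x b
  have h4 := le_maxAction q' x a
  rw [abs_le]
  constructor <;> linarith

theorem abs_maxAction_le [Fintype A] [Nonempty A] {q : X × A → ℝ} {B : ℝ}
    (h : ∀ z, |q z| ≤ B) (x : X) : |maxAction q x| ≤ B := by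
  obtain ⟨a, ha⟩ := exists_maxAction_eq q x
  rw [ha]
  exact h _

end MaxAction

section OptimalValue

variable {X A : Type*} [MeasurableSpace X] [MeasurableSpace A] {d : ℕ}

theorem measurable_maxAction [Fintype A] [Nonempty A] {q : X × A → ℝ} (hq : Measurable q) :
    Measurable (maxAction q) := by
  have : maxAction q = Finset.univ.sup' Finset.univ_nonempty fun a x => q (x, a) := by
    funext x
    simp [maxAction]
  rw [this]
  exact Finset.measurable_sup' _ fun a _ => hq.comp measurable_prodMk_right

/-- Maximizers over a finite action set can be selected measurably: take the first maximizer in an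
enumeration of the actions. -/
theorem exists_measurable_greedy [Fintype A] [Nonempty A] [DiscreteMeasurableSpace A]
    {q : X × A → ℝ} (hq : Measurable q) :
    ∃ g : X → A, Measurable g ∧ ∀ x, q (x, g x) = maxAction q x := by
  classical
  obtain ⟨f, hf⟩ := exists_surjective_nat A
  have ex : ∀ x, ∃ n, q (x, f n) = maxAction q x := by
    intro x
    obtain ⟨a, ha⟩ := exists_maxAction_eq q x
    obtain ⟨n, rfl⟩ := hf a
    exact ⟨n, ha.symm⟩
  refine ⟨fun x => f (Nat.find (ex x)), ?_, fun x => Nat.find_spec (ex x)⟩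
  have hm : Measurable fun x => Nat.find (ex x) := by
    refine measurable_find ex fun k => ?_
    exact measurableSet_eq_fun (hq.comp measurable_prodMk_right) (measurable_maxAction hq)
  exact (measurable_from_nat (f := f)).comp hm

/-- The one-step lookahead `r + γ P v` of a function `v` of the state. -/
noncomputable def LinearMDP.lookahead (m : LinearMDP X A d) (v : X → ℝ) (z : X × A) : ℝ :=
  m.r z + m.γ * ∫ y, v y ∂(m.P z)

theorem LinearMDP.measurable_lookahead (m : LinearMDP X A d) {v : X → ℝ} (hv : Measurable v) :
    Measurable (m.lookahead v) := by
  have h1 : Measurable fun z => ∫ y, v y ∂(m.P z) :=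
    ((hv.comp measurable_snd).stronglyMeasurable.integral_kernel_prod_right'
      (κ := m.P)).measurable
  exact m.r_measurable.add (h1.const_mul _)

/-- The lookahead is monotone and scales constants by `γ`. -/
theorem LinearMDP.lookahead_le_add (m : LinearMDP X A d) {v v' : X → ℝ} (hv : Measurable v)
    (hv' : Measurable v') {B B' : ℝ} (hB : ∀ x, |v x| ≤ B) (hB' : ∀ x, |v' x| ≤ B') {D : ℝ}
    (hD : ∀ x, v x ≤ v' x + D) (z : X × A) :
    m.lookahead v z ≤ m.lookahead v' z + m.γ * D := by
  have i1 := integrable_of_bound (m.P z) hv hB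
  have i2 := integrable_of_bound (m.P z) hv' hB'
  have h : ∫ y, v y ∂(m.P z) ≤ ∫ y, v' y ∂(m.P z) + D := by
    calc ∫ y, v y ∂(m.P z) ≤ ∫ y, (v' y + D) ∂(m.P z) :=
          integral_mono i1 (i2.add (integrable_const _)) hD
      _ = _ := by rw [integral_add i2 (integrable_const _)]; simp
  have := mul_le_mul_of_nonneg_left h m.γ_nonneg
  unfold LinearMDP.lookahead
  linarith

theorem LinearMDP.abs_lookahead_sub_le (m : LinearMDP X A d) {v v' : X → ℝ} (hv : Measurable v)
    (hv' : Measurable v') {B B' : ℝ} (hB : ∀ x, |v x| ≤ B) (hB' : ∀ x, |v' x| ≤ B') {D : ℝ}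
    (hD : ∀ x, |v x - v' x| ≤ D) (z : X × A) :
    |m.lookahead v z - m.lookahead v' z| ≤ m.γ * D := by
  have h1 := m.lookahead_le_add hv hv' hB hB' (D := D)
    (fun x => by linarith [(abs_le.1 (hD x)).2]) z
  have h2 := m.lookahead_le_add hv' hv hB' hB (D := D)
    (fun x => by linarith [(abs_le.1 (hD x)).1]) z
  rw [abs_le]
  constructor <;> linarith

theorem LinearMDP.abs_lookahead_le (m : LinearMDP X A d) {v : X → ℝ} {B : ℝ}
    (hB : ∀ x, |v x| ≤ B) (z : X × A) : |m.lookahead v z| ≤ 1 + m.γ * B := by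
  have h2 : |m.r z| ≤ 1 := abs_le.2 (m.r_bound z)
  have h1 := mul_le_mul_of_nonneg_left (abs_integral_le_of_bound (m.P z) hB) m.γ_nonneg
  calc |m.lookahead v z| ≤ |m.r z| + |m.γ * ∫ y, v y ∂(m.P z)| := abs_add_le _ _
    _ ≤ _ := by
      rw [abs_mul, abs_of_nonneg m.γ_nonneg]
      linarith

theorem LinearMDP.one_sub_γ_pos (m : LinearMDP X A d) : 0 < 1 - m.γ := sub_pos.2 m.γ_lt_one

theorem LinearMDP.one_le_H (m : LinearMDP X A d) : 1 ≤ m.H := by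
  rw [LinearMDP.H, le_div_iff₀ m.one_sub_γ_pos]
  linarith [m.γ_nonneg]

theorem LinearMDP.H_eq (m : LinearMDP X A d) : 1 + m.γ * m.H = m.H := by
  have := m.one_sub_γ_pos
  unfold LinearMDP.H
  field_simp
  ring

/-- Value iteration converges to a bounded measurable fixed point of the optimal Bellman
operator. -/
theorem LinearMDP.exists_bellman_optimal [Fintype A] [Nonempty A] (m : LinearMDP X A d) :
    ∃ V : X → ℝ, Measurable V ∧ (∀ x, |V x| ≤ m.H) ∧ ∀ x, V x = maxAction (m.lookahead V) x := by
  have g0 := m.γ_nonneg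
  have g1 := m.γ_lt_one
  have hH := m.H_eq
  set T : (X → ℝ) → X → ℝ := fun v => maxAction (m.lookahead v) with hT
  set u : ℕ → X → ℝ := fun n => T^[n] (fun _ => 0) with hu
  have us : ∀ n, u (n + 1) = T (u n) := fun n => by
    simp only [hu, Function.iterate_succ_apply']
  have um : ∀ n, Measurable (u n) := by
    intro n
    induction n with
    | zero => exact measurable_const
    | succ n ih => rw [us]; exact measurable_maxAction (m.measurable_lookahead ih)
  have ub : ∀ n x, |u n x| ≤ m.H := by
    intro n
    induction n with
    | zero =>
      intro x
      simp only [hu, Function.iterate_zero, id, abs_zero]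
      linarith [m.one_le_H]
    | succ n ih =>
      intro x
      rw [us]
      exact abs_maxAction_le (fun z => (m.abs_lookahead_le ih z).trans_eq hH) x
  have contract : ∀ {v v' : X → ℝ}, Measurable v → Measurable v' → (∀ x, |v x| ≤ m.H) →
      (∀ x, |v' x| ≤ m.H) → ∀ {D : ℝ}, (∀ x, |v x - v' x| ≤ D) →
      ∀ x, |T v x - T v' x| ≤ m.γ * D := fun hv hv' hB hB' D hD x =>
    abs_maxAction_sub_le (m.abs_lookahead_sub_le hv hv' hB hB' hD) x
  have ud : ∀ n x, |u n x - u (n + 1) x| ≤ m.H * m.γ ^ n := by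
    intro n
    induction n with
    | zero =>
      intro x
      have h := ub 1 x
      have h0 : u 0 x = 0 := rfl
      rw [h0, zero_sub, abs_neg, pow_zero, mul_one]
      exact h
    | succ n ih =>
      intro x
      rw [us n, us (n + 1)]
      refine (contract (um _) (um _) (ub _) (ub _) ih x).trans_eq ?_
      ring
  have uc : ∀ x, CauchySeq fun n => u n x := fun x =>
    cauchySeq_of_le_geometric _ _ g1 fun n => by rw [Real.dist_eq]; exact ud n x
  choose V hV using fun x => cauchySeq_tendsto_of_complete (uc x)
  have Vm : Measurable V := measurable_of_tendsto_metrizable um (tendsto_pi_nhds.2 hV)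
  have Vb : ∀ x, |V x| ≤ m.H := fun x =>
    le_of_tendsto (hV x).abs (Filter.Eventually.of_forall fun n => ub n x)
  have Vd : ∀ n x, |u n x - V x| ≤ m.H * m.γ ^ n / (1 - m.γ) := by
    intro n x
    have := dist_le_of_le_geometric_of_tendsto (f := fun n => u n x) _ _ g1
      (fun n => by rw [Real.dist_eq]; exact ud n x) (hV x) n
    rwa [Real.dist_eq] at this
  refine ⟨V, Vm, Vb, fun x => ?_⟩
  have t1 : Filter.Tendsto (fun n => u (n + 1) x) Filter.atTop (nhds (V x)) :=
    (hV x).comp (Filter.tendsto_add_atTop_nat 1)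
  have t2 : Filter.Tendsto (fun n => u (n + 1) x) Filter.atTop (nhds (T V x)) := by
    rw [tendsto_iff_dist_tendsto_zero]
    have t3 : Filter.Tendsto (fun n : ℕ => m.γ * (m.H * m.γ ^ n / (1 - m.γ)))
        Filter.atTop (nhds 0) := by
      have := (((tendsto_pow_atTop_nhds_zero_of_lt_one g0 g1).const_mul m.H).div_const
        (1 - m.γ)).const_mul m.γ
      simpa using this
    refine squeeze_zero (fun _ => dist_nonneg) (fun n => ?_) t3
    rw [Real.dist_eq, us]
    exact contract (um n) Vm (ub n) Vb (Vd n) x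
  exact tendsto_nhds_unique t1 t2

theorem le_zero_of_forall_le_pow_mul {g c a : ℝ} (g0 : 0 ≤ g) (g1 : g < 1)
    (h : ∀ n : ℕ, a ≤ g ^ n * c) : a ≤ 0 := by
  have t : Filter.Tendsto (fun n : ℕ => g ^ n * c) Filter.atTop (nhds 0) := by
    simpa using (tendsto_pow_atTop_nhds_zero_of_lt_one g0 g1).mul_const c
  exact ge_of_tendsto' t h

theorem LinearMDP.isActionValue_actionValue (m : LinearMDP X A d) (π : Policy X A) :
    m.IsActionValue π (m.actionValue π) :=
  Classical.choose_spec (m.existsUnique_actionValue π).exists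

theorem LinearMDP.measurable_stateValue (m : LinearMDP X A d) (π : Policy X A) :
    Measurable (m.stateValue π) :=
  π.apply_measurable (m.isActionValue_actionValue π).1

theorem LinearMDP.exists_abs_stateValue_le (m : LinearMDP X A d) (π : Policy X A) :
    ∃ B, ∀ x, |m.stateValue π x| ≤ B := by
  have := π.2
  obtain ⟨B, hB⟩ := (m.isActionValue_actionValue π).2.1
  exact ⟨B, fun x => abs_integral_le_of_bound _ fun a => hB (x, a)⟩

/-- `v_π = π (r + γ P v_π)`. -/
theorem LinearMDP.stateValue_eq (m : LinearMDP X A d) (π : Policy X A) (x : X) :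
    m.stateValue π x = ∫ a, m.lookahead (m.stateValue π) (x, a) ∂(π.1 x) :=
  integral_congr_ae (Filter.Eventually.of_forall fun a =>
    ((m.isActionValue_actionValue π).2.2 (x, a)).symm)

/-- A bounded measurable fixed point of the optimal Bellman operator is the optimal value
function: it dominates the value of every policy, and the policy that is greedy for it attains
it. -/
theorem LinearMDP.optimalValue_eq_of_fixedPoint [Fintype A] [Nonempty A]
    [DiscreteMeasurableSpace A] (m : LinearMDP X A d) {V : X → ℝ} (Vm : Measurable V)
    (Vb : ∀ x, |V x| ≤ m.H) (hV : ∀ x, V x = maxAction (m.lookahead V) x) (x : X) :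
    m.optimalValue x = V x := by
  have g0 := m.γ_nonneg
  have g1 := m.γ_lt_one
  have upper : ∀ (π : Policy X A) x, m.stateValue π x ≤ V x := by
    intro π x
    have := π.2
    have vm := m.measurable_stateValue π
    obtain ⟨B, hB⟩ := m.exists_abs_stateValue_le π
    have key : ∀ (n : ℕ) x, m.stateValue π x ≤ V x + m.γ ^ n * (B + m.H) := by
      intro n
      induction n with
      | zero =>
        intro x
        have := (abs_le.1 (hB x)).2
        have := (abs_le.1 (Vb x)).1
        linarith
      | succ n ih =>
        intro x
        rw [m.stateValue_eq]
        have h : ∀ a, m.lookahead (m.stateValue π) (x, a)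
            ≤ V x + m.γ ^ (n + 1) * (B + m.H) := by
          intro a
          refine (m.lookahead_le_add vm Vm hB Vb ih (x, a)).trans ?_
          have := le_maxAction (m.lookahead V) x a
          rw [hV x, pow_succ']
          linarith
        calc ∫ a, m.lookahead (m.stateValue π) (x, a) ∂(π.1 x)
            ≤ ∫ _, (V x + m.γ ^ (n + 1) * (B + m.H)) ∂(π.1 x) :=
              integral_mono (integrable_of_bound _
                ((m.measurable_lookahead vm).comp measurable_prodMk_left)
                fun a => m.abs_lookahead_le hB (x, a)) (integrable_const _) h
          _ = _ := by simp
    have := le_zero_of_forall_le_pow_mul (a := m.stateValue π x - V x) (c := B + m.H) g0 g1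
      fun n => by linarith [key n x]
    linarith
  obtain ⟨g, gm, hg⟩ := exists_measurable_greedy (m.measurable_lookahead Vm)
  let π : Policy X A := ⟨Kernel.deterministic g gm, inferInstance⟩
  have lower : V x ≤ m.stateValue π x := by
    have vm := m.measurable_stateValue π
    obtain ⟨B, hB⟩ := m.exists_abs_stateValue_le π
    have key : ∀ (n : ℕ) x, V x ≤ m.stateValue π x + m.γ ^ n * (B + m.H) := by
      intro n
      induction n with
      | zero =>
        intro x
        have := (abs_le.1 (hB x)).1
        have := (abs_le.1 (Vb x)).2
        linarith
      | succ n ih =>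
        intro x
        have e : m.stateValue π x = m.lookahead (m.stateValue π) (x, g x) := by
          rw [m.stateValue_eq]
          change ∫ a, _ ∂(Kernel.deterministic g gm x) = _
          rw [Kernel.deterministic_apply, integral_dirac]
        rw [hV x, ← hg x, e, pow_succ']
        have := m.lookahead_le_add Vm vm Vb hB ih (x, g x)
        linarith
    have := le_zero_of_forall_le_pow_mul (a := V x - m.stateValue π x) (c := B + m.H) g0 g1
      fun n => by linarith [key n x]
    linarith
  have : Nonempty (Policy X A) := ⟨π⟩
  refine le_antisymm (ciSup_le fun π => upper π x) (lower.trans ?_)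
  exact le_ciSup (f := fun π => m.stateValue π x)
    ⟨V x, by rintro _ ⟨π, rfl⟩; exact upper π x⟩ π

end OptimalValue

/-! ### Error propagation -/

section ErrorPropagation

variable {X A : Type*} [MeasurableSpace X] [MeasurableSpace A] {d : ℕ}

/-- The functions produced by `K` passes of value iteration with averaging weight `γ`, in which
each lookahead is computed up to an error `E`: `s k` is the averaged action value function, `w k`
its maximum over the actions, `wp k` the maximum one step before and `v k` their weighted
difference. -/
structure LinearMDP.IsApproxIteration [Fintype A] [Nonempty A] (m : LinearMDP X A d) (E : ℝ)
    (K : ℕ) (s : ℕ → X × A → ℝ) (w wp v : ℕ → X → ℝ) : Prop where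
  s_zero : ∀ z, s 0 z = 0
  wp_zero : ∀ x, wp 0 x = 0
  wp_succ : ∀ k, wp (k + 1) = w k
  w_eq : ∀ k, w k = maxAction (s k)
  v_eq : ∀ k x, v k x = w k x - m.γ * wp k x
  measurable_w : ∀ k, Measurable (w k)
  bounded_w : ∀ k, ∃ B, ∀ x, |w k x| ≤ B
  error_le : ∀ k < K, ∀ z, |s (k + 1) z - m.γ * s k z - m.lookahead (v k) z| ≤ E

namespace LinearMDP.IsApproxIteration

variable [Fintype A] [Nonempty A] {m : LinearMDP X A d} {E : ℝ} {K : ℕ}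
  {s : ℕ → X × A → ℝ} {w wp v : ℕ → X → ℝ}

theorem measurable_wp (h : m.IsApproxIteration E K s w wp v) (k : ℕ) : Measurable (wp k) := by
  cases k with
  | zero => rw [funext h.wp_zero]; exact measurable_const
  | succ k => rw [h.wp_succ]; exact h.measurable_w k

theorem bounded_wp (h : m.IsApproxIteration E K s w wp v) (k : ℕ) :
    ∃ B, ∀ x, |wp k x| ≤ B := by
  cases k with
  | zero => exact ⟨0, fun x => by rw [h.wp_zero, abs_zero]⟩
  | succ k => rw [h.wp_succ]; exact h.bounded_w k

theorem measurable_v (h : m.IsApproxIteration E K s w wp v) (k : ℕ) : Measurable (v k) := by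
  rw [funext (h.v_eq k)]
  exact (h.measurable_w k).sub ((h.measurable_wp k).const_mul _)

theorem bounded_v (h : m.IsApproxIteration E K s w wp v) (k : ℕ) : ∃ B, ∀ x, |v k x| ≤ B := by
  obtain ⟨B, hB⟩ := h.bounded_w k
  obtain ⟨B', hB'⟩ := h.bounded_wp k
  refine ⟨B + m.γ * B', fun x => ?_⟩
  rw [h.v_eq]
  refine (abs_sub _ _).trans (add_le_add (hB x) ?_)
  rw [abs_mul, abs_of_nonneg m.γ_nonneg]
  exact mul_le_mul_of_nonneg_left (hB' x) m.γ_nonneg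

theorem w_zero (h : m.IsApproxIteration E K s w wp v) (x : X) : w 0 x = 0 := by
  obtain ⟨a, ha⟩ := exists_maxAction_eq (s 0) x
  rw [h.w_eq, ha, h.s_zero]

theorem v_zero (h : m.IsApproxIteration E K s w wp v) (x : X) : v 0 x = 0 := by
  rw [h.v_eq, h.w_zero, h.wp_zero]
  ring

/-- Testing both maxima in `v (k + 1)` at an action that is greedy for `s (k + 1)`. -/
theorem exists_v_succ_le (h : m.IsApproxIteration E K s w wp v) {k : ℕ} (hk : k < K) (x : X) :
    ∃ a, v (k + 1) x ≤ m.lookahead (v k) (x, a) + E := by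
  obtain ⟨a, ha⟩ := exists_maxAction_eq (s (k + 1)) x
  refine ⟨a, ?_⟩
  have h1 := mul_le_mul_of_nonneg_left (le_maxAction (s k) x a) m.γ_nonneg
  have h2 := (abs_le.1 (h.error_le k hk (x, a))).2
  rw [h.v_eq, h.wp_succ, h.w_eq, h.w_eq, ha]
  linarith

/-- Testing both maxima in `v (k + 1)` at an action that is greedy for `s k`. -/
theorem le_v_succ (h : m.IsApproxIteration E K s w wp v) {k : ℕ} (hk : k < K) {x : X} {a : A}
    (ha : maxAction (s k) x = s k (x, a)) : m.lookahead (v k) (x, a) - E ≤ v (k + 1) x := by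
  have h1 := le_maxAction (s (k + 1)) x a
  have h2 := (abs_le.1 (h.error_le k hk (x, a))).1
  rw [h.v_eq, h.wp_succ, h.w_eq, h.w_eq, ha]
  linarith

theorem abs_v_le (h : m.IsApproxIteration E K s w wp v) (hE : E ≤ 1) :
    ∀ k ≤ K, ∀ x, |v k x| ≤ 2 * m.H := by
  have hH := m.H_eq
  have h1 := m.one_le_H
  intro k
  induction k with
  | zero =>
    intro _ x
    rw [h.v_zero, abs_zero]
    linarith
  | succ k ih =>
    intro hk x
    have ih' := ih (by omega)
    obtain ⟨a, ha⟩ := h.exists_v_succ_le (by omega : k < K) x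
    obtain ⟨b, hb⟩ := exists_maxAction_eq (s k) x
    have hb' := h.le_v_succ (by omega : k < K) hb
    have l1 := (abs_le.1 (m.abs_lookahead_le ih' (x, a))).2
    have l2 := (abs_le.1 (m.abs_lookahead_le ih' (x, b))).1
    rw [abs_le]
    constructor <;> linarith

/-- The iterates exceed the optimal value by little. -/
theorem v_le (h : m.IsApproxIteration E K s w wp v) (hE : 0 ≤ E) {V : X → ℝ} (Vm : Measurable V)
    (Vb : ∀ x, |V x| ≤ m.H) (hV : ∀ x, V x = maxAction (m.lookahead V) x) :
    ∀ k ≤ K, ∀ x, v k x ≤ V x + (m.γ ^ k * m.H + m.H * E) := by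
  have hH := m.H_eq
  intro k
  induction k with
  | zero =>
    intro _ x
    rw [h.v_zero]
    have h1 := (abs_le.1 (Vb x)).1
    have h2 := mul_nonneg (zero_le_one.trans m.one_le_H) hE
    linarith
  | succ k ih =>
    intro hk x
    obtain ⟨a, ha⟩ := h.exists_v_succ_le (by omega : k < K) x
    obtain ⟨B, hB⟩ := h.bounded_v k
    have h1 := m.lookahead_le_add (h.measurable_v k) Vm hB Vb (ih (by omega)) (x, a)
    have h2 := le_maxAction (m.lookahead V) x a
    rw [← hV] at h2
    have h3 : m.γ * (m.γ ^ k * m.H + m.H * E) + E = m.γ ^ (k + 1) * m.H + m.H * E := by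
      rw [pow_succ']
      linear_combination E * hH
    linarith

/-- The averaged action value function is an approximate lookahead of the previous maximum, for
rewards that are scaled by `∑ j < k, γ ^ j = H (1 - γ ^ k)`. -/
theorem abs_s_sub_le (h : m.IsApproxIteration E K s w wp v) (hE : 0 ≤ E) :
    ∀ k ≤ K, ∀ z, |s k z - m.H * (1 - m.γ ^ k) * m.r z - m.γ * ∫ y, wp k y ∂(m.P z)|
      ≤ m.H * E := by
  have hH := m.H_eq
  intro k
  induction k with
  | zero =>
    intro _ z
    simp only [h.s_zero, h.wp_zero]
    simpa using mul_nonneg (zero_le_one.trans m.one_le_H) hE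
  | succ k ih =>
    intro hk z
    have h1 := h.error_le k (by omega) z
    have h2 := ih (by omega) z
    have e : ∫ y, v k y ∂(m.P z) = ∫ y, wp (k + 1) y ∂(m.P z) - m.γ * ∫ y, wp k y ∂(m.P z) := by
      obtain ⟨B, hB⟩ := h.bounded_w k
      obtain ⟨B', hB'⟩ := h.bounded_wp k
      rw [← integral_const_mul, h.wp_succ, ← integral_sub
        (integrable_of_bound _ (h.measurable_w k) hB)
        ((integrable_of_bound _ (h.measurable_wp k) hB').const_mul _)]
      exact integral_congr_ae (Filter.Eventually.of_forall (h.v_eq k))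
    rw [LinearMDP.lookahead, e] at h1
    have h3 := mul_le_mul_of_nonneg_left h2 m.γ_nonneg
    rw [← abs_of_nonneg m.γ_nonneg, ← abs_mul, abs_of_nonneg m.γ_nonneg] at h3
    have h4 := (abs_add_le _ _).trans (add_le_add h1 h3)
    have h5 : E + m.γ * (m.H * E) = m.H * E := by linear_combination E * hH
    rw [h5] at h4
    refine (congrArg abs ?_).le.trans h4
    rw [pow_succ']
    linear_combination m.r z * hH

/-- The rescaled maxima are not far below the optimal value. -/
theorem optimal_le_w (h : m.IsApproxIteration E K s w wp v) (hE : 0 ≤ E) {V : X → ℝ}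
    (Vm : Measurable V) (Vb : ∀ x, |V x| ≤ m.H) (hV : ∀ x, V x = maxAction (m.lookahead V) x) :
    ∀ k ≤ K, ∀ x, V x ≤ w k x / m.H + (m.γ ^ k * (m.H + k) + m.H * E) := by
  have hH := m.H_eq
  have H0 : 0 < m.H := zero_lt_one.trans_le m.one_le_H
  intro k
  induction k with
  | zero =>
    intro _ x
    rw [h.w_zero]
    have h1 := (abs_le.1 (Vb x)).2
    have h2 := mul_nonneg H0.le hE
    simp only [zero_div, pow_zero, Nat.cast_zero]
    linarith
  | succ k ih =>
    intro hk x
    obtain ⟨a, ha⟩ := exists_maxAction_eq (m.lookahead V) x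
    obtain ⟨B, hB⟩ := h.bounded_w k
    have wm : Measurable fun y => w k y / m.H := (h.measurable_w k).div_const _
    have wb : ∀ y, |w k y / m.H| ≤ B / m.H := fun y => by
      rw [abs_div, abs_of_pos H0]
      gcongr
      exact hB y
    have h1 := m.lookahead_le_add Vm wm Vb wb (ih (by omega)) (x, a)
    have h2 := (abs_le.1 (h.abs_s_sub_le hE (k + 1) hk (x, a))).1
    have h3 := le_maxAction (s (k + 1)) x a
    have h4 := (m.r_bound (x, a)).2
    have g0 := pow_nonneg m.γ_nonneg (k + 1)
    rw [← h.w_eq] at h3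
    rw [h.wp_succ] at h2
    rw [hV x, ha]
    refine h1.trans ?_
    rw [LinearMDP.lookahead, integral_div]
    -- divide the lower bound for `w (k + 1)` by `H`
    have h5 : (m.H * (1 - m.γ ^ (k + 1)) * m.r (x, a) + m.γ * (∫ y, w k y ∂(m.P (x, a)))
        - m.H * E) / m.H ≤ w (k + 1) x / m.H := by
      gcongr
      linarith
    have h6 : (m.H * (1 - m.γ ^ (k + 1)) * m.r (x, a) + m.γ * (∫ y, w k y ∂(m.P (x, a)))
        - m.H * E) / m.H = (1 - m.γ ^ (k + 1)) * m.r (x, a)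
          + m.γ * ((∫ y, w k y ∂(m.P (x, a))) / m.H) - E := by
      field_simp
    rw [h6] at h5
    have h7 : m.γ * (m.γ ^ k * (m.H + k) + m.H * E) + m.γ ^ (k + 1) + E
        = m.γ ^ (k + 1) * (m.H + (k + 1 : ℕ)) + m.H * E := by
      push_cast
      rw [pow_succ']
      linear_combination E * hH
    have h8 := mul_le_mul_of_nonneg_left h4 g0
    linarith

/-- The output is not far below the rescaled maxima one step before. Both are evaluated at the
action that is greedy for `s k`, so the difference contracts although the iterates are not values
of a single policy. -/
theorem w_le_v_succ (h : m.IsApproxIteration E K s w wp v) (hE : 0 ≤ E) :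
    ∀ k < K, ∀ x, w k x / m.H ≤ v (k + 1) x + (m.γ ^ k * (k + 1) + 2 * (m.H * E)) := by
  have hH := m.H_eq
  have H0 : 0 < m.H := zero_lt_one.trans_le m.one_le_H
  have main : ∀ k < K, ∀ {D : ℝ}, (∀ x, wp k x / m.H ≤ v k x + D) →
      ∀ x, w k x / m.H ≤ v (k + 1) x + (m.γ * D + m.γ ^ k + 2 * E) := by
    intro k hk D hD x
    obtain ⟨a, ha⟩ := exists_maxAction_eq (s k) x
    have h1 := h.le_v_succ hk ha
    have h2 := (abs_le.1 (h.abs_s_sub_le hE k hk.le (x, a))).2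
    have h4 := (m.r_bound (x, a)).1
    have g0 := pow_nonneg m.γ_nonneg k
    obtain ⟨B, hB⟩ := h.bounded_wp k
    obtain ⟨B', hB'⟩ := h.bounded_v k
    have wm : Measurable fun y => wp k y / m.H := (h.measurable_wp k).div_const _
    have wb : ∀ y, |wp k y / m.H| ≤ B / m.H := fun y => by
      rw [abs_div, abs_of_pos H0]
      gcongr
      exact hB y
    have h3 := m.lookahead_le_add wm (h.measurable_v k) wb hB' hD (x, a)
    rw [LinearMDP.lookahead, integral_div] at h3
    rw [h.w_eq, ha]
    have h5 : s k (x, a) / m.H ≤ (m.H * (1 - m.γ ^ k) * m.r (x, a)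
        + m.γ * (∫ y, wp k y ∂(m.P (x, a))) + m.H * E) / m.H := by
      gcongr
      linarith
    have h6 : (m.H * (1 - m.γ ^ k) * m.r (x, a)
        + m.γ * (∫ y, wp k y ∂(m.P (x, a))) + m.H * E) / m.H = (1 - m.γ ^ k) * m.r (x, a)
          + m.γ * ((∫ y, wp k y ∂(m.P (x, a))) / m.H) + E := by
      field_simp
    rw [h6] at h5
    have h8 := mul_le_mul_of_nonneg_left h4 g0
    linarith
  intro k
  induction k with
  | zero =>
    intro hk x
    have h1 := main 0 hk (D := 0) (fun x => by rw [h.wp_zero, h.v_zero]; simp) x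
    have h2 := mul_le_mul_of_nonneg_right m.one_le_H hE
    simp only [pow_zero, Nat.cast_zero] at h1 ⊢
    linarith
  | succ k ih =>
    intro hk x
    have h1 := main (k + 1) hk (by rw [h.wp_succ]; exact ih (by omega)) x
    have h7 : m.γ * (m.γ ^ k * (k + 1) + 2 * (m.H * E)) + m.γ ^ (k + 1) + 2 * E
        = m.γ ^ (k + 1) * ((k + 1 : ℕ) + 1) + 2 * (m.H * E) := by
      push_cast
      rw [pow_succ']
      linear_combination 2 * E * hH
    rw [h7] at h1
    exact h1

/-- The last iterate is close to the optimal value. -/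
theorem abs_optimalValue_sub_le [DiscreteMeasurableSpace A] {k : ℕ}
    (h : m.IsApproxIteration E (k + 1) s w wp v) (hE : 0 ≤ E) (x : X) :
    |m.optimalValue x - v (k + 1) x| ≤ m.γ ^ k * (m.H + 2 * k + 1) + 3 * (m.H * E) := by
  obtain ⟨V, Vm, Vb, hV⟩ := m.exists_bellman_optimal
  rw [m.optimalValue_eq_of_fixedPoint Vm Vb hV]
  have h1 := h.v_le hE Vm Vb hV (k + 1) le_rfl x
  have h2 := h.optimal_le_w hE Vm Vb hV k (by omega) x
  have h3 := h.w_le_v_succ hE k (by omega) x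
  have H1 := m.one_le_H
  have g0 := pow_nonneg m.γ_nonneg k
  have h4 : m.γ ^ (k + 1) * m.H ≤ m.γ ^ k * m.H := by
    have := pow_le_pow_of_le_one m.γ_nonneg m.γ_lt_one.le (Nat.le_succ k)
    gcongr
  have h5 : 0 ≤ m.γ ^ k * (2 * k + 1) := by positivity
  have h6 : 0 ≤ m.H * E := by positivity
  rw [abs_le]
  constructor <;> linarith

end LinearMDP.IsApproxIteration
end ErrorPropagation

/-! ### Least squares on the core set -/

section Regression

variable {X A : Type*} [MeasurableSpace X] [MeasurableSpace A] {d : ℕ}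

theorem LinearMDP.designMatrix_mulVec (m : LinearMDP X A d) (f : X × A → ℝ) (ρ : (X × A) →₀ ℝ)
    (t : Fin d → ℝ) :
    m.designMatrix f ρ *ᵥ t
      = ∑ z : ρ.support, (ρ z / f z ^ 2 * (m.φ z ⬝ᵥ t)) • m.φ z := by
  unfold LinearMDP.designMatrix
  rw [← Finset.sum_coe_sort, Matrix.sum_mulVec]
  refine Finset.sum_congr rfl fun z _ => ?_
  rw [Matrix.smul_mulVec, Matrix.vecMulVec_mulVec]
  ext i
  simp [mul_assoc, mul_comm, mul_left_comm]

/-- The least-squares parameter solves the normal equations. -/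
theorem LinearMDP.leastSquares_eq (m : LinearMDP X A d) {f : X × A → ℝ} {ρ : (X × A) →₀ ℝ}
    (hρ : IsDesign ρ) (hG : IsUnit (m.designMatrix f ρ).det) (q : ρ.support → ℝ) :
    m.leastSquares f ρ q
      = (m.designMatrix f ρ)⁻¹ *ᵥ ∑ z : ρ.support, (ρ z / f z ^ 2 * q z) • m.φ z := by
  set b : Fin d → ℝ := ∑ z : ρ.support, (ρ z / f z ^ 2 * q z) • m.φ z with hb
  set t0 := (m.designMatrix f ρ)⁻¹ *ᵥ b with ht0
  have hGt0 : m.designMatrix f ρ *ᵥ t0 = b := by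
    rw [ht0, Matrix.mulVec_mulVec, Matrix.mul_nonsing_inv _ hG, Matrix.one_mulVec]
  have min0 : ∀ t, m.loss f ρ q t0 ≤ m.loss f ρ q t := by
    intro t
    -- the residual of `t0` is orthogonal to all features
    have cross : ∑ z : ρ.support,
        ρ z / f z ^ 2 * (m.φ z ⬝ᵥ t0 - q z) * (m.φ z ⬝ᵥ (t - t0)) = 0 := by
      have h1 : (∑ z : ρ.support,
          (ρ z / f z ^ 2 * (m.φ z ⬝ᵥ t0) - ρ z / f z ^ 2 * q z) • m.φ z) = 0 := by
        simp only [sub_smul, Finset.sum_sub_distrib]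
        rw [← m.designMatrix_mulVec, hGt0, hb, sub_self]
      have h2 := congrArg (fun v => v ⬝ᵥ (t - t0)) h1
      simp only [sum_dotProduct, smul_dotProduct, zero_dotProduct, smul_eq_mul] at h2
      rw [← h2]
      exact Finset.sum_congr rfl fun z _ => by ring
    have h3 : m.loss f ρ q t = m.loss f ρ q t0
        + ∑ z : ρ.support, ρ z / f z ^ 2 * (m.φ z ⬝ᵥ (t - t0)) ^ 2
        + 2 * ∑ z : ρ.support,
          ρ z / f z ^ 2 * (m.φ z ⬝ᵥ t0 - q z) * (m.φ z ⬝ᵥ (t - t0)) := by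
      unfold LinearMDP.loss
      rw [Finset.mul_sum, ← Finset.sum_add_distrib, ← Finset.sum_add_distrib]
      refine Finset.sum_congr rfl fun z _ => ?_
      rw [dotProduct_sub]
      ring
    have h4 : 0 ≤ ∑ z : ρ.support, ρ z / f z ^ 2 * (m.φ z ⬝ᵥ (t - t0)) ^ 2 :=
      Finset.sum_nonneg fun z _ =>
        mul_nonneg (div_nonneg (hρ.nonneg _) (sq_nonneg _)) (sq_nonneg _)
    rw [h3, cross]
    linarith
  have hls : ∀ t, m.loss f ρ q (m.leastSquares f ρ q) ≤ m.loss f ρ q t :=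
    Classical.epsilon_spec (p := fun θ => ∀ θ', m.loss f ρ q θ ≤ m.loss f ρ q θ') ⟨t0, min0⟩
  exact (m.existsUnique_leastSquares f ρ hρ hG q).unique hls min0

theorem LinearMDP.leastSquares_measurable (m : LinearMDP X A d) {f : X × A → ℝ}
    {ρ : (X × A) →₀ ℝ} (hρ : IsDesign ρ) (hG : IsUnit (m.designMatrix f ρ).det) :
    Measurable (m.leastSquares f ρ) := by
  refine Continuous.measurable ?_
  rw [funext (m.leastSquares_eq hρ hG)]
  exact Continuous.matrix_mulVec continuous_const (by fun_prop)

/-- If the targets differ from those of the parameter `θ` by at most `t`, the least-squares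
prediction differs from that of `θ` by at most `t √(2 d)` everywhere: by the Cauchy-Schwarz
inequality, the factor is at most the square root of `φ(z)ᵀ G⁻¹ φ(z) ≤ 2 d`. -/
theorem LinearMDP.abs_dotProduct_leastSquares_sub_le (m : LinearMDP X A d) {ρ : (X × A) →₀ ℝ}
    (hρ : m.IsWeightedOptimalDesign (fun _ => 1) ρ) {q : ρ.support → ℝ} {θ : Fin d → ℝ} {t : ℝ}
    (ht : 0 ≤ t) (hq : ∀ z : ρ.support, |q z - m.φ z ⬝ᵥ θ| ≤ t) (z : X × A) :
    |m.φ z ⬝ᵥ m.leastSquares (fun _ => 1) ρ q - m.φ z ⬝ᵥ θ| ≤ t * √(2 * d) := by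
  have hG := hρ.invertible
  have hd := hρ.isDesign
  set G := m.designMatrix (fun _ => 1) ρ with hGdef
  have Gsymm : Gᵀ = G := by
    rw [hGdef]
    unfold LinearMDP.designMatrix
    rw [Matrix.transpose_sum]
    refine Finset.sum_congr rfl fun z _ => ?_
    rw [Matrix.transpose_smul, Matrix.transpose_vecMulVec]
  have Ginvsymm : (G⁻¹)ᵀ = G⁻¹ := by rw [Matrix.transpose_nonsing_inv, Gsymm]
  set c : ρ.support → ℝ := fun z' => m.φ z' ⬝ᵥ G⁻¹ *ᵥ m.φ z with hc
  have move : ∀ y, m.φ z ⬝ᵥ G⁻¹ *ᵥ y = y ⬝ᵥ G⁻¹ *ᵥ m.φ z := by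
    intro y
    rw [Matrix.dotProduct_mulVec, ← Matrix.mulVec_transpose, Ginvsymm, dotProduct_comm]
  have e1 : m.φ z ⬝ᵥ m.leastSquares (fun _ => 1) ρ q - m.φ z ⬝ᵥ θ
      = ∑ z' : ρ.support, ρ z' * c z' * (q z' - m.φ z' ⬝ᵥ θ) := by
    have e2 : θ = G⁻¹ *ᵥ ∑ z' : ρ.support, (ρ z' / 1 ^ 2 * (m.φ z' ⬝ᵥ θ)) • m.φ z' := by
      rw [← m.designMatrix_mulVec (fun _ => 1) ρ θ, Matrix.mulVec_mulVec, ← hGdef,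
        Matrix.nonsing_inv_mul _ hG, Matrix.one_mulVec]
    conv_lhs => rw [m.leastSquares_eq hd hG, e2]
    rw [move, move, sum_dotProduct, sum_dotProduct, ← Finset.sum_sub_distrib]
    refine Finset.sum_congr rfl fun z' _ => ?_
    simp only [smul_dotProduct, smul_eq_mul, hc]
    ring
  have e3 : ∑ z' : ρ.support, ρ z' * c z' ^ 2 ≤ 2 * d := by
    have h := hρ.value_le z
    have e4 : ∑ z' : ρ.support, ρ z' * c z' ^ 2 = m.φ z ⬝ᵥ G⁻¹ *ᵥ m.φ z := by
      have e5 := m.designMatrix_mulVec (fun _ => 1) ρ (G⁻¹ *ᵥ m.φ z)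
      rw [Matrix.mulVec_mulVec, ← hGdef, Matrix.mul_nonsing_inv _ hG, Matrix.one_mulVec] at e5
      conv_rhs => rw [move]; arg 1; rw [e5]
      rw [sum_dotProduct]
      refine Finset.sum_congr rfl fun z' _ => ?_
      simp only [smul_dotProduct, smul_eq_mul, hc]
      ring
    rw [e4]
    simpa using h
  have sum1 : ∑ z' : ρ.support, ρ z' = 1 := by
    rw [Finset.sum_coe_sort ρ.support (fun z => ρ z)]
    exact hd.sum_eq_one
  have cs : ∑ z' : ρ.support, ρ z' * |c z'| ≤ √(2 * d) := by
    refine Real.le_sqrt_of_sq_le ?_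
    have h := Finset.sum_mul_sq_le_sq_mul_sq Finset.univ (fun z' : ρ.support => √(ρ z'))
      (fun z' => √(ρ z') * |c z'|)
    have h1 : ∀ z' : ρ.support, √(ρ z') * (√(ρ z') * |c z'|) = ρ z' * |c z'| := fun z' => by
      rw [← mul_assoc, Real.mul_self_sqrt (hd.nonneg _)]
    have h2 : ∀ z' : ρ.support, (√(ρ z') * |c z'|) ^ 2 = ρ z' * c z' ^ 2 := fun z' => by
      rw [mul_pow, Real.sq_sqrt (hd.nonneg _), sq_abs]
    simp only [h1, h2, Real.sq_sqrt (hd.nonneg _), sum1, one_mul] at h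
    exact h.trans e3
  rw [e1]
  calc |∑ z' : ρ.support, ρ z' * c z' * (q z' - m.φ z' ⬝ᵥ θ)|
      ≤ ∑ z' : ρ.support, ρ z' * |c z'| * t := by
        refine (Finset.abs_sum_le_sum_abs _ _).trans (Finset.sum_le_sum fun z' _ => ?_)
        rw [abs_mul, abs_mul, abs_of_nonneg (hd.nonneg _)]
        exact mul_le_mul_of_nonneg_left (hq z') (mul_nonneg (hd.nonneg _) (abs_nonneg _))
    _ = t * ∑ z' : ρ.support, ρ z' * |c z'| := by rw [← Finset.sum_mul, mul_comm]
    _ ≤ t * √(2 * d) := mul_le_mul_of_nonneg_left cs ht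

end Regression

/-! ### Linearity of the lookahead in the features -/

section LinearTransition

variable {X A : Type*} [MeasurableSpace X] [MeasurableSpace A] {d : ℕ}

theorem signedMeasure_eq_jordan (μ : SignedMeasure X) {B : Set X} (hB : MeasurableSet B) :
    μ B = μ.toJordanDecomposition.posPart.real B - μ.toJordanDecomposition.negPart.real B := by
  conv_lhs => rw [← μ.toSignedMeasure_toJordanDecomposition]
  rw [JordanDecomposition.toSignedMeasure, Measure.toSignedMeasure_sub_apply hB]

/-- If a probability measure is a linear combination of signed measures, so are its integrals of
bounded measurable functions. Moving all negative terms of the Jordan decompositions and of the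
coefficients to the other side gives an equality of finite measures, which can be integrated. -/
theorem integral_eq_sum_jordan (ν : Measure X) [IsProbabilityMeasure ν]
    (μ : Fin d → SignedMeasure X) (c : Fin d → ℝ)
    (h : ∀ B, MeasurableSet B → ν.real B = ∑ i, c i * μ i B) {v : X → ℝ} (hv : Measurable v)
    {K : ℝ} (hK : ∀ x, |v x| ≤ K) :
    ∫ x, v x ∂ν = ∑ i, c i * (∫ x, v x ∂(μ i).toJordanDecomposition.posPart
      - ∫ x, v x ∂(μ i).toJordanDecomposition.negPart) := by
  set p : Fin d → Measure X := fun i => (μ i).toJordanDecomposition.posPart with hp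
  set n : Fin d → Measure X := fun i => (μ i).toJordanDecomposition.negPart with hn
  have pf : ∀ i, IsFiniteMeasure (p i) := fun i =>
    (μ i).toJordanDecomposition.posPart_finite
  have nf : ∀ i, IsFiniteMeasure (n i) := fun i =>
    (μ i).toJordanDecomposition.negPart_finite
  set a : Fin d → NNReal := fun i => (c i).toNNReal
  set b : Fin d → NNReal := fun i => (-c i).toNNReal
  have hab : ∀ i, c i = a i - b i := by
    intro i
    simp only [a, b, Real.coe_toNNReal']
    rcases le_total 0 (c i) with h | h
    · rw [max_eq_left h, max_eq_right (by linarith)]; ring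
    · rw [max_eq_right h, max_eq_left (by linarith)]; ring
  have key : ν + ∑ i, (b i • p i + a i • n i) = ∑ i, (a i • p i + b i • n i) := by
    ext B hB
    have e := h B hB
    have sumreal : ∀ κ : Fin d → Measure X, (∀ i, IsFiniteMeasure (κ i)) →
        (∑ i, κ i).real B = ∑ i, (κ i).real B := by
      intro κ hκ
      rw [Measure.real, Measure.finsetSum_apply, ENNReal.toReal_sum fun i _ => measure_ne_top _ _]
      rfl
    rw [← ENNReal.toReal_eq_toReal_iff' (measure_ne_top _ _) (measure_ne_top _ _)]
    change (ν + ∑ i, (b i • p i + a i • n i)).real B = (∑ i, (a i • p i + b i • n i)).real B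
    rw [measureReal_add_apply, sumreal _ fun i => inferInstance, sumreal _ fun i => inferInstance,
      e, ← Finset.sum_add_distrib]
    refine Finset.sum_congr rfl fun i _ => ?_
    rw [signedMeasure_eq_jordan _ hB, measureReal_add_apply, measureReal_add_apply]
    simp only [measureReal_nnreal_smul_apply]
    rw [hab i]
    ring
  have int : ∀ (κ : Measure X) [IsFiniteMeasure κ], Integrable v κ := fun κ _ =>
    Integrable.of_bound hv.aestronglyMeasurable K (Filter.Eventually.of_forall hK)
  have ie := congrArg (fun κ => ∫ x, v x ∂κ) key
  rw [integral_add_measure (int _) (int _), integral_finsetSum_measure (fun i _ => int _),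
    integral_finsetSum_measure (fun i _ => int _)] at ie
  simp only [integral_add_measure (int _) (int _), integral_smul_nnreal_measure] at ie
  rw [eq_sub_of_add_eq ie, ← Finset.sum_sub_distrib]
  refine Finset.sum_congr rfl fun i _ => ?_
  rw [hab i]
  simp only [NNReal.smul_def, smul_eq_mul]
  ring

theorem LinearMDP.exists_lookahead_eq_dotProduct (m : LinearMDP X A d) {v : X → ℝ}
    (hv : Measurable v) {B : ℝ} (hB : ∀ x, |v x| ≤ B) :
    ∃ θ : Fin d → ℝ, ∀ z, m.lookahead v z = m.φ z ⬝ᵥ θ := by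
  obtain ⟨ψ, hψ⟩ := m.reward_linear
  obtain ⟨μ, hμ⟩ := m.transition_linear
  refine ⟨ψ + m.γ • fun i => ∫ x, v x ∂(μ i).toJordanDecomposition.posPart
      - ∫ x, v x ∂(μ i).toJordanDecomposition.negPart, fun z => ?_⟩
  rw [LinearMDP.lookahead, hψ, integral_eq_sum_jordan (m.P z) μ (m.φ z) (hμ z) hv hB,
    dotProduct_add, dotProduct_smul, smul_eq_mul]
  rfl

end LinearTransition

/-! ### Concentration for product measures -/

section Concentration

variable {X : Type*} [MeasurableSpace X]

/-- Hoeffding's inequality for the empirical mean of `M` coordinates of a product measure that have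
the same law. -/
theorem measure_pi_lt_abs_empiricalMean_sub_le {ι : Type*} [Fintype ι] (ν : ι → Measure X)
    [∀ i, IsProbabilityMeasure (ν i)] {M : ℕ} (hM : 0 < M) {e : Fin M → ι}
    (he : Function.Injective e) {ν₀ : Measure X} (hν : ∀ n, ν (e n) = ν₀) {g : X → ℝ}
    (hg : Measurable g) {B t : ℝ} (ht : 0 ≤ t) (hB : ∀ x, |g x| ≤ B) :
    Measure.pi ν {b | t < |1 / (M : ℝ) * ∑ n, g (b (e n)) - ∫ x, g x ∂ν₀|}
      ≤ ENNReal.ofReal (2 * Real.exp (-(M * t ^ 2 / (2 * B ^ 2)))) := by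
  have M0 : (0 : ℝ) < M := by exact_mod_cast hM
  set Z : Fin M → (ι → X) → ℝ := fun n b => g (b (e n)) - ∫ x, g x ∂ν₀ with hZ
  have mean : ∀ i, ∫ b, g (b i) ∂(Measure.pi ν) = ∫ x, g x ∂(ν i) := fun i => by
      rw [← (measurePreserving_eval ν i).map_eq, integral_map (measurable_pi_apply i).aemeasurable
        hg.aestronglyMeasurable]
  have indep : iIndepFun Z (Measure.pi ν) :=
    (iIndepFun_pi (X := fun _ x => g x - ∫ x, g x ∂ν₀) fun i =>
      (hg.sub_const _).aemeasurable).precomp he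
  have subG : ∀ n, HasSubgaussianMGF (Z n) ((‖B - -B‖₊ / 2) ^ 2) (Measure.pi ν) := by
    intro n
    have h := hasSubgaussianMGF_of_mem_Icc (μ := Measure.pi ν) (X := fun b => g (b (e n)))
      (a := -B) (b := B) (hg.comp (measurable_pi_apply _)).aemeasurable
      (Filter.Eventually.of_forall fun b => abs_le.1 (hB _))
    rwa [mean, hν] at h
  have tail : ∀ W : Fin M → (ι → X) → ℝ, iIndepFun W (Measure.pi ν) →
      (∀ n, HasSubgaussianMGF (W n) ((‖B - -B‖₊ / 2) ^ 2) (Measure.pi ν)) →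
      (Measure.pi ν).real {b | M * t ≤ ∑ n, W n b}
        ≤ Real.exp (-(M * t ^ 2 / (2 * B ^ 2))) := by
    intro W hW hs
    refine (HasSubgaussianMGF.measure_sum_ge_le_of_iIndepFun hW (s := Finset.univ)
      (fun n _ => hs n) (by positivity)).trans_eq ?_
    congr 1
    have : ((∑ _n : Fin M, (‖B - -B‖₊ / 2) ^ 2 : NNReal) : ℝ) = M * B ^ 2 := by
      simp only [Finset.sum_const, Finset.card_univ, Fintype.card_fin, nsmul_eq_mul]
      push_cast
      rw [div_pow, Real.norm_eq_abs, sq_abs]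
      ring
    rw [this]
    by_cases hB0 : B = 0
    · simp [hB0]
    · field_simp
  have upper := tail Z indep subG
  have lower := tail (fun n b => -Z n b)
    (indep.comp (fun _ u => -u) fun _ => measurable_neg) fun n => (subG n).neg
  have sub : {b : ι → X | t < |1 / (M : ℝ) * ∑ n, g (b (e n)) - ∫ x, g x ∂ν₀|}
      ⊆ {b | M * t ≤ ∑ n, Z n b} ∪ {b | M * t ≤ ∑ n, -Z n b} := by
    intro b hb
    have e1 : M * (1 / (M : ℝ) * ∑ n, g (b (e n)) - ∫ x, g x ∂ν₀) = ∑ n, Z n b := by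
      simp only [hZ, Finset.sum_sub_distrib, Finset.sum_const, Finset.card_univ,
        Fintype.card_fin, nsmul_eq_mul]
      field_simp
    have e2 : M * t ≤ |∑ n, Z n b| := by
      rw [← e1, abs_mul, abs_of_pos M0]
      exact mul_le_mul_of_nonneg_left (le_of_lt hb) M0.le
    rcases le_abs.1 e2 with h | h
    · exact Or.inl h
    · exact Or.inr (by simpa only [Set.mem_ofPred_eq, Finset.sum_neg_distrib] using h)
  refine (measure_mono sub).trans ?_
  rw [← ofReal_measureReal]
  refine ENNReal.ofReal_le_ofReal ((measureReal_union_le _ _).trans ?_)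
  linarith

/-- Conditioning on the coordinates outside `p`: a set is at most as likely as its most likely
slice. -/
theorem measure_pi_le_of_slices {ι : Type*} [Fintype ι] (ν : ι → Measure X)
    [∀ i, IsProbabilityMeasure (ν i)] (p : ι → Prop) [DecidablePred p] {S : Set (ι → X)}
    (hS : MeasurableSet S) {c : ENNReal}
    (h : ∀ b : {i // ¬p i} → X, Measure.pi (fun i : {i // p i} => ν i)
      {a | (fun i => if hi : p i then a ⟨i, hi⟩ else b ⟨i, hi⟩) ∈ S} ≤ c) :
    Measure.pi ν S ≤ c := by
  set e := MeasurableEquiv.piEquivPiSubtypeProd (fun _ : ι => X) p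
  have mp := (measurePreserving_piEquivPiSubtypeProd ν p).symm e
  rw [← mp.measure_preimage hS.nullMeasurableSet,
    Measure.prod_apply_symm (e.symm.measurable hS)]
  calc _ ≤ ∫⁻ _, c ∂(Measure.pi fun i : {i // ¬p i} => ν i) := lintegral_mono fun b => h b
    _ = c := by simp

end Concentration

/-! ### The noise of the iterates -/

section Batches

variable {X A : Type*} [MeasurableSpace X]

/-- The answers of the generative model as a sequence of batches, continued by a constant. -/
def batches {K M : ℕ} {C : Finset (X × A)} (x₀ : X) (y : Call K M C → X) (k : ℕ) (n : Fin M)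
    (z : C) : X :=
  if h : k < K then y (⟨k, h⟩, n, z) else x₀

theorem measurable_batches {K M : ℕ} {C : Finset (X × A)} (x₀ : X) (k : ℕ) (n : Fin M) (z : C) :
    Measurable fun y : Call K M C → X => batches x₀ y k n z := by
  unfold batches
  split_ifs
  · exact measurable_pi_apply _
  · exact measurable_const

end Batches

section Noise

variable {X A : Type*} [MeasurableSpace X] [MeasurableSpace A] {d : ℕ}

/-- The state after `k` passes of the unweighted main loop on an infinite sequence of batches, of
which only the first `k` are used. -/
noncomputable def LinearMDP.iterates [Fintype A] [Nonempty A] (m : LinearMDP X A d)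
    (ρ : (X × A) →₀ ℝ) {M : ℕ} (Y : ℕ → Fin M → ρ.support → X) : ℕ → LoopState X d
  | 0 => initialState X d
  | k + 1 => m.step m.γ (fun _ => 1) ρ (Y k) (m.iterates ρ Y k)

section

variable [Fintype A] [Nonempty A] {m : LinearMDP X A d} {ρ : (X × A) →₀ ℝ} {M : ℕ}

theorem LinearMDP.run_eq_iterates (Y : ℕ → Fin M → ρ.support → X) (K : ℕ) :
    m.run m.γ (fun _ => 1) ρ M K (fun k => Y k) = m.iterates ρ Y K := by
  induction K with
  | zero => rfl
  | succ K ih =>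
    rw [LinearMDP.run, LinearMDP.iterates, ← ih]
    rfl

theorem LinearMDP.iterates_congr {Y Y' : ℕ → Fin M → ρ.support → X} {k : ℕ}
    (h : ∀ j < k, Y j = Y' j) : m.iterates ρ Y k = m.iterates ρ Y' k := by
  induction k with
  | zero => rfl
  | succ k ih =>
    rw [LinearMDP.iterates, LinearMDP.iterates, ih fun j hj => h j (by omega), h k (by omega)]

/-- The iterates are jointly measurable in the samples and the state. -/
theorem LinearMDP.measurable_iterates (hρ : m.IsWeightedOptimalDesign (fun _ => 1) ρ)
    {Ω : Type*} [MeasurableSpace Ω] {Y : Ω → ℕ → Fin M → ρ.support → X}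
    (hY : ∀ k n z, Measurable fun ω => Y ω k n z) (k : ℕ) :
    Measurable (fun ω => (m.iterates ρ (Y ω) k).thetaBar) ∧
    Measurable (fun u : Ω × X => (m.iterates ρ (Y u.1) k).w u.2) ∧
    Measurable (fun u : Ω × X => (m.iterates ρ (Y u.1) k).wPrev u.2) := by
  induction k with
  | zero => exact ⟨measurable_const, measurable_const, measurable_const⟩
  | succ k ih =>
    obtain ⟨h1, h2, h3⟩ := ih
    have hv : Measurable fun u : Ω × X => (m.iterates ρ (Y u.1) k).v m.γ u.2 :=
      h2.sub (h3.const_mul _)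
    have ht : Measurable fun ω => (m.iterates ρ (Y ω) (k + 1)).thetaBar := by
      refine Measurable.add ((m.leastSquares_measurable hρ.isDesign hρ.invertible).comp ?_)
        (h1.const_smul m.γ)
      refine measurable_pi_lambda _ fun z => ?_
      refine measurable_const.add (measurable_const.mul (measurable_const.mul ?_))
      exact Finset.measurable_sum _ fun n _ => hv.comp (measurable_id.prodMk (hY k n z))
    refine ⟨ht, ?_, h2⟩
    refine measurable_maxAction
      (q := fun u : (Ω × X) × A => m.φ (u.1.2, u.2) ⬝ᵥ (m.iterates ρ (Y u.1.1) (k + 1)).thetaBar) ?_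
    have p1 : Measurable fun u : (Ω × X) × A => m.φ (u.1.2, u.2) :=
      m.φ_measurable.comp (by fun_prop)
    have p2 : Measurable fun u : (Ω × X) × A => (m.iterates ρ (Y u.1.1) (k + 1)).thetaBar :=
      ht.comp (by fun_prop)
    exact Finset.measurable_sum _ fun i _ =>
      ((measurable_pi_apply i).comp p1).mul ((measurable_pi_apply i).comp p2)

end

theorem LinearMDP.exists_abs_dotProduct_le (m : LinearMDP X A d) (θ : Fin d → ℝ) :
    ∃ B, ∀ z, |m.φ z ⬝ᵥ θ| ≤ B := by
  obtain ⟨B, hB⟩ := m.compact_features.exists_bound_of_continuousOn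
    (f := fun u : Fin d → ℝ => u ⬝ᵥ θ) (by unfold dotProduct; fun_prop)
  exact ⟨B, fun z => hB _ ⟨z, rfl⟩⟩

/-- Truncation to `[-B, B]`. -/
def clip (B u : ℝ) : ℝ := max (-B) (min u B)

theorem measurable_clip (B : ℝ) : Measurable (clip B) :=
  measurable_const.max (measurable_id.min measurable_const)

theorem abs_clip_le {B : ℝ} (hB : 0 ≤ B) (u : ℝ) : |clip B u| ≤ B :=
  abs_le.2 ⟨le_max_left _ _, max_le (by linarith) (min_le_right _ _)⟩

theorem clip_eq {B u : ℝ} (h : |u| ≤ B) : clip B u = u := by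
  rw [clip, min_eq_left (abs_le.1 h).2, max_eq_right (abs_le.1 h).1]

variable [Fintype A] [Nonempty A]

/-- The truncated iterate `v_k`, as a function of the samples. Truncation makes it bounded for all
samples, so that Hoeffding's inequality applies before the iterates are known to be bounded. -/
noncomputable def LinearMDP.clippedIterate (m : LinearMDP X A d) (ρ : (X × A) →₀ ℝ) {K M : ℕ}
    (x₀ : X) (k : ℕ) (y : Call K M ρ.support → X) (x : X) : ℝ :=
  clip (2 * m.H) ((m.iterates ρ (batches x₀ y) k).v m.γ x)

/-- The event that the empirical mean of the truncated iterate `v_k` at the core set element `z` is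
off by more than `t`. -/
def LinearMDP.badEvent (m : LinearMDP X A d) (ρ : (X × A) →₀ ℝ) {K M : ℕ} (x₀ : X) (t : ℝ)
    (k : Fin K) (z : ρ.support) : Set (Call K M ρ.support → X) :=
  {y | t < |1 / (M : ℝ) * ∑ n, m.clippedIterate ρ x₀ k y (y (k, n, z))
    - ∫ x, m.clippedIterate ρ x₀ k y x ∂(m.P z)|}

variable {m : LinearMDP X A d} {ρ : (X × A) →₀ ℝ} {K M : ℕ}

theorem LinearMDP.measurable_clippedIterate (hρ : m.IsWeightedOptimalDesign (fun _ => 1) ρ)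
    (x₀ : X) (k : ℕ) :
    Measurable fun u : (Call K M ρ.support → X) × X => m.clippedIterate ρ x₀ k u.1 u.2 := by
  obtain ⟨-, h2, h3⟩ := m.measurable_iterates hρ
    (Y := fun y : Call K M ρ.support → X => batches x₀ y) (measurable_batches x₀) k
  exact (measurable_clip _).comp (h2.sub (h3.const_mul _))

theorem LinearMDP.measurableSet_badEvent (hρ : m.IsWeightedOptimalDesign (fun _ => 1) ρ)
    (x₀ : X) (t : ℝ) (k : Fin K) (z : ρ.support) :
    MeasurableSet (m.badEvent ρ (M := M) x₀ t k z) := by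
  have h := m.measurable_clippedIterate (K := K) (M := M) hρ x₀ k
  have h1 : Measurable fun y : Call K M ρ.support → X =>
      ∑ n, m.clippedIterate ρ x₀ k y (y (k, n, z)) :=
    Finset.measurable_sum _ fun n _ => h.comp (measurable_id.prodMk (measurable_pi_apply _))
  have h2 : Measurable fun y : Call K M ρ.support → X =>
      ∫ x, m.clippedIterate ρ x₀ k y x ∂(m.P z) :=
    (h.stronglyMeasurable.integral_prod_right' (ν := m.P z)).measurable
  exact measurableSet_lt measurable_const ((h1.const_mul _).sub h2).abs

/-- Given the other batches, `v_k` is a fixed function and batch `k` is independent of it, so that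
Hoeffding's inequality applies. -/
theorem LinearMDP.measure_badEvent_le (hρ : m.IsWeightedOptimalDesign (fun _ => 1) ρ)
    (hM : 0 < M) (x₀ : X) {t : ℝ} (ht : 0 ≤ t) (k : Fin K) (z : ρ.support) :
    m.sampleLaw K M ρ.support (m.badEvent ρ x₀ t k z)
      ≤ ENNReal.ofReal (2 * Real.exp (-(M * t ^ 2 / (2 * (2 * m.H) ^ 2)))) := by
  classical
  refine measure_pi_le_of_slices _ (fun i : Call K M ρ.support => i.1 = k)
    (m.measurableSet_badEvent hρ x₀ t k z) fun b => ?_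
  set glue : ({i : Call K M ρ.support // i.1 = k} → X) → Call K M ρ.support → X :=
    fun a i => if hi : i.1 = k then a ⟨i, hi⟩ else b ⟨i, hi⟩ with hglue
  set g := m.clippedIterate ρ x₀ k (glue fun _ => x₀) with hg
  have past : ∀ a, m.clippedIterate ρ x₀ k (glue a) = g := by
    intro a
    funext x
    rw [hg, LinearMDP.clippedIterate, LinearMDP.clippedIterate,
      m.iterates_congr (Y := batches x₀ (glue a)) (Y' := batches x₀ (glue fun _ => x₀))]
    intro j hj
    funext n z'
    have hjK : j < K := hj.trans k.2
    have hne : (⟨j, hjK⟩ : Fin K) ≠ k := fun h => by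
      rw [← h] at hj
      exact lt_irrefl _ hj
    simp only [batches, hjK, dif_pos, hglue, hne, dif_neg, not_false_eq_true]
  have gm : Measurable g :=
    (m.measurable_clippedIterate hρ x₀ k).comp measurable_prodMk_left
  have gb : ∀ x, |g x| ≤ 2 * m.H := fun x =>
    abs_clip_le (by linarith [m.one_le_H]) _
  refine (measure_mono fun a ha => ?_).trans
    (measure_pi_lt_abs_empiricalMean_sub_le
      (fun i : {i : Call K M ρ.support // i.1 = k} => m.P i.1.2.2) hM
      (ν₀ := m.P z) (e := fun n => ⟨(k, n, z), rfl⟩) (fun n n' h => by simpa using h)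
      (fun _ => rfl) gm ht gb)
  have ha' : glue a ∈ m.badEvent ρ x₀ t k z := ha
  simp only [LinearMDP.badEvent, Set.mem_ofPred_eq, past a] at ha'
  simpa only [hglue, dif_pos, Set.mem_ofPred_eq] using ha'

/-- Outside the bad events the loop is an approximate value iteration. The bound on `v_k` that
makes the truncation harmless at pass `k` comes from the passes before it. -/
theorem LinearMDP.isApproxIteration_of_notMem_badEvent
    (hρ : m.IsWeightedOptimalDesign (fun _ => 1) ρ) (x₀ : X) {t : ℝ} (ht : 0 ≤ t)
    (hE : t * √(2 * d) ≤ 1) {y : Call K M ρ.support → X}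
    (hy : ∀ k z, y ∉ m.badEvent ρ x₀ t k z) :
    ∀ k ≤ K, m.IsApproxIteration (t * √(2 * d)) k
      (fun j z => m.φ z ⬝ᵥ (m.iterates ρ (batches x₀ y) j).thetaBar)
      (fun j => (m.iterates ρ (batches x₀ y) j).w)
      (fun j => (m.iterates ρ (batches x₀ y) j).wPrev)
      (fun j => (m.iterates ρ (batches x₀ y) j).v m.γ) := by
  have hw : ∀ j, (m.iterates ρ (batches x₀ y) j).w
      = maxAction fun z => m.φ z ⬝ᵥ (m.iterates ρ (batches x₀ y) j).thetaBar := by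
    intro j
    cases j with
    | succ j => rfl
    | zero =>
      funext x
      simp [LinearMDP.iterates, initialState, maxAction]
  have hm : ∀ j, Measurable (m.iterates ρ (batches x₀ y) j).w := fun j =>
    (m.measurable_iterates hρ (Y := fun y : Call K M ρ.support → X => batches x₀ y)
      (measurable_batches x₀) j).2.1.comp measurable_prodMk_left
  intro k
  induction k with
  | zero =>
    refine fun _ => ⟨fun z => ?_, fun x => rfl, fun k => rfl, hw, fun k x => rfl, hm, fun j => ?_,
      fun k hk => absurd hk (Nat.not_lt_zero k)⟩
    · simp [LinearMDP.iterates, initialState]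
    · obtain ⟨B, hB⟩ := m.exists_abs_dotProduct_le (m.iterates ρ (batches x₀ y) j).thetaBar
      exact ⟨B, fun x => by rw [hw]; exact abs_maxAction_le hB x⟩
  | succ k ih =>
    intro hk
    have h := ih (by omega)
    refine { h with error_le := fun j hj z => ?_ }
    rcases Nat.lt_succ_iff_lt_or_eq.1 hj with hj | rfl
    · exact h.error_le j hj z
    have vb := h.abs_v_le hE j le_rfl
    have vm := h.measurable_v j
    obtain ⟨θ, hθ⟩ := m.exists_lookahead_eq_dotProduct vm vb
    have e1 : m.φ z ⬝ᵥ (m.iterates ρ (batches x₀ y) (j + 1)).thetaBar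
        - m.γ * (m.φ z ⬝ᵥ (m.iterates ρ (batches x₀ y) j).thetaBar)
        = m.φ z ⬝ᵥ m.leastSquares (fun _ => 1) ρ
          (m.target ((m.iterates ρ (batches x₀ y) j).v m.γ) (batches x₀ y j)) := by
      rw [LinearMDP.iterates, LinearMDP.step, dotProduct_add, dotProduct_smul, smul_eq_mul]
      ring
    rw [e1, hθ z]
    refine m.abs_dotProduct_leastSquares_sub_le hρ ht (fun z' => ?_) z
    have hjK : j < K := by omega
    have good := hy ⟨j, hjK⟩ z'
    have ec : m.clippedIterate ρ x₀ j y = (m.iterates ρ (batches x₀ y) j).v m.γ :=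
      funext fun x => clip_eq (vb x)
    have eb : ∀ n, y (⟨j, hjK⟩, n, z') = batches x₀ y j n z' := fun n => by
      simp only [batches, hjK, dif_pos]
    simp only [LinearMDP.badEvent, Set.mem_ofPred_eq, not_lt, ec, eb] at good
    rw [← hθ, LinearMDP.target, LinearMDP.lookahead, add_sub_add_left_eq_sub, ← mul_sub, abs_mul,
      abs_of_nonneg m.γ_nonneg]
    exact (mul_le_of_le_one_left (abs_nonneg _) m.γ_lt_one.le).trans good

/-- The output is accurate outside the union of the bad events. -/
theorem LinearMDP.measure_not_accurate_le [DiscreteMeasurableSpace A]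
    (hρ : m.IsWeightedOptimalDesign (fun _ => 1) ρ) (hM : 0 < M) (x₀ : X) {t : ℝ} (ht : 0 ≤ t)
    (hE : t * √(2 * d) ≤ 1) {k : ℕ} :
    m.sampleLaw (k + 1) M ρ.support
      {y | ¬ ∀ x, |m.optimalValue x - m.wlsMDVI m.γ (fun _ => 1) ρ (k + 1) M y x|
        ≤ m.γ ^ k * (m.H + 2 * k + 1) + 3 * (m.H * (t * √(2 * d)))}
      ≤ ENNReal.ofReal ((k + 1 : ℕ) * ρ.support.card
        * (2 * Real.exp (-(M * t ^ 2 / (2 * (2 * m.H) ^ 2))))) := by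
  set c := 2 * Real.exp (-(M * t ^ 2 / (2 * (2 * m.H) ^ 2))) with hc
  have sub : {y : Call (k + 1) M ρ.support → X |
      ¬ ∀ x, |m.optimalValue x - m.wlsMDVI m.γ (fun _ => 1) ρ (k + 1) M y x|
        ≤ m.γ ^ k * (m.H + 2 * k + 1) + 3 * (m.H * (t * √(2 * d)))}
      ⊆ ⋃ i : Fin (k + 1) × ρ.support, m.badEvent ρ x₀ t i.1 i.2 := by
    intro y hy
    by_contra hbad
    simp only [Set.mem_iUnion, not_exists, Prod.forall] at hbad
    refine hy fun x => ?_
    have h := m.isApproxIteration_of_notMem_badEvent hρ x₀ ht hE hbad (k + 1) le_rfl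
    have e : m.wlsMDVI m.γ (fun _ => 1) ρ (k + 1) M y
        = (m.iterates ρ (batches x₀ y) (k + 1)).v m.γ := by
      have e' : (fun (j : Fin (k + 1)) n z => y (j, n, z)) =
          fun j : Fin (k + 1) => batches x₀ y j := by
        funext j n z
        simp only [batches, Fin.is_lt, dif_pos, Fin.eta]
      rw [LinearMDP.wlsMDVI, ← m.run_eq_iterates, e']
    rw [e]
    exact h.abs_optimalValue_sub_le (by positivity) x
  calc _ ≤ _ := measure_mono sub
    _ ≤ ∑ i : Fin (k + 1) × ρ.support,
          m.sampleLaw (k + 1) M ρ.support (m.badEvent ρ x₀ t i.1 i.2) :=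
        measure_iUnion_fintype_le _ _
    _ ≤ ∑ _i : Fin (k + 1) × ρ.support, ENNReal.ofReal c :=
        Finset.sum_le_sum fun i _ => m.measure_badEvent_le hρ hM x₀ ht i.1 i.2
    _ = ENNReal.ofReal ((k + 1 : ℕ) * ρ.support.card * c) := by
        rw [Finset.sum_const, nsmul_eq_mul, Finset.card_univ, Fintype.card_prod, Fintype.card_fin,
          Fintype.card_coe, ← Nat.cast_mul, ENNReal.ofReal_mul (Nat.cast_nonneg _),
          ENNReal.ofReal_natCast]

end Noise

/-! ### The choice of the parameters -/

section Parameters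

theorem coreBound_ge {d : ℕ} : 28 ≤ coreBound d := by
  have h1 : (1 : ℝ) ≤ Real.log (d + 4) := by
    rw [Real.le_log_iff_exp_le (by positivity)]
    have := Real.exp_one_lt_d9
    have : (0 : ℝ) ≤ d := Nat.cast_nonneg d
    linarith
  have h2 := Real.log_nonneg h1
  have : 0 ≤ 4 * d * Real.log (Real.log (d + 4)) := by positivity
  unfold coreBound
  linarith

/-- After `3 H log (7 H)` passes the influence of the initialization is small. -/
theorem pow_mul_le_of_le {g H : ℝ} (g0 : 0 ≤ g) (g1 : g < 1) (hH : H = 1 / (1 - g)) {k : ℕ}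
    (hk : 3 * H * Real.log (7 * H) ≤ k) (hk' : k ≤ 3 * H * Real.log (7 * H) + 1) :
    g ^ k * (H + 2 * k + 1) ≤ 1 / 4 := by
  have hg : 0 < 1 - g := sub_pos.2 g1
  have H1 : 1 ≤ H := by
    rw [hH, le_div_iff₀ hg]
    linarith
  have H0 : 0 < H := by linarith
  have e : 1 - g = 1 / H := by rw [hH, one_div_one_div]
  have h1 : g ^ k ≤ 1 / (7 * H) ^ 3 := by
    calc g ^ k ≤ Real.exp (-(1 / H)) ^ k := by
          gcongr
          rw [← e]
          linarith [Real.add_one_le_exp (-(1 - g))]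
      _ = Real.exp (-(k / H)) := by
          rw [← Real.exp_nat_mul]
          congr 1
          ring
      _ ≤ Real.exp (-(3 * Real.log (7 * H))) := by
          gcongr
          rw [le_div_iff₀ H0]
          linarith
      _ = 1 / (7 * H) ^ 3 := by
          rw [Real.exp_neg, one_div, show 3 * Real.log (7 * H) = ((3 : ℕ) : ℝ) * Real.log (7 * H) by
            norm_num, Real.exp_nat_mul, Real.exp_log (by positivity)]
  have h2 : Real.log (7 * H) ≤ 7 * H :=
    (Real.log_le_sub_one_of_pos (by positivity)).trans (by linarith)
  have h3 : H + 2 * k + 1 ≤ 46 * H ^ 2 := by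
    have : 3 * H * Real.log (7 * H) ≤ 3 * H * (7 * H) := by gcongr
    nlinarith
  calc g ^ k * (H + 2 * k + 1) ≤ 1 / (7 * H) ^ 3 * (46 * H ^ 2) := by gcongr
    _ = 46 / 343 / H := by field_simp; norm_num
    _ ≤ 46 / 343 / 1 := by gcongr
    _ ≤ 1 / 4 := by norm_num

/-- The number of passes is one more than some `k` that satisfies the assumptions of
`pow_mul_le_of_le`. -/
theorem exists_numIterations_eq {g H : ℝ} (hH : H = 1 / (1 - g)) (H1 : 1 ≤ H) :
    ∃ k : ℕ, numIterations 7 g H = k + 1 ∧ 3 * H * Real.log (7 * H) ≤ k ∧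
      k ≤ 3 * H * Real.log (7 * H) + 1 := by
  have hl : 0 ≤ Real.log (7 * H) := Real.log_nonneg (by linarith)
  have e : 3 / (1 - g) = 3 * H := by rw [hH]; ring
  have h0 : 0 ≤ 3 * H * Real.log (7 * H) + 1 := by positivity
  have h1 := Nat.le_ceil (3 * H * Real.log (7 * H) + 1)
  have h2 := (Nat.ceil_lt_add_one h0).le
  have pos : 0 < ⌈3 * H * Real.log (7 * H) + 1⌉₊ := Nat.ceil_pos.2 (by positivity)
  obtain ⟨k, hk⟩ := Nat.exists_eq_add_one.2 pos
  refine ⟨k, by rw [numIterations, e, hk], ?_, ?_⟩ <;> rw [hk] at h1 h2 <;> push_cast at h1 h2 <;>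
    linarith

/-- The total failure probability allowed by the union bound. -/
theorem union_bound_le {c₀ u δ n M d H ε : ℝ} {K : ℕ} (h6 : 6 ≤ c₀) (h8 : c₀ ≤ 8) (hK : 1 ≤ K)
    (hu : 28 ≤ u) (hn : n ≤ u) (hd : 1 ≤ d) (hH : 1 ≤ H) (hε : 0 < ε) (hεH : ε ≤ 1 / H)
    (hδ : 0 < δ) (hδ1 : δ < 1)
    (hM : 2304 * d * H ^ 2 / ε * Real.log (2 * c₀ ^ 2 * u * K / ((c₀ - 5) * δ)) ≤ M) :
    K * n * (2 * Real.exp (-(M * (1 / (12 * √H * √(2 * d))) ^ 2 / (2 * (2 * H) ^ 2))))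
      ≤ 3 * δ / c₀ := by
  have K1 : (1 : ℝ) ≤ K := by exact_mod_cast hK
  have c5 : 0 < c₀ - 5 := by linarith
  set R := 2 * c₀ ^ 2 * u * K / ((c₀ - 5) * δ) with hR
  have R1 : 1 ≤ R := by
    rw [hR, le_div_iff₀ (by positivity)]
    have a1 : (c₀ - 5) * δ ≤ 3 * 1 := by gcongr; linarith
    have a2 : (2 * 6 ^ 2 * 28 * 1 : ℝ) ≤ 2 * c₀ ^ 2 * u * K := by gcongr
    linarith
  have L0 := Real.log_nonneg R1
  have e : M * (1 / (12 * √H * √(2 * d))) ^ 2 / (2 * (2 * H) ^ 2) = M / (2304 * d * H ^ 3) := by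
    rw [div_pow, mul_pow, mul_pow, Real.sq_sqrt (by linarith), Real.sq_sqrt (by linarith)]
    field_simp
    ring
  have h1 : Real.log R ≤ M / (2304 * d * H ^ 3) := by
    rw [le_div_iff₀ (by positivity)]
    refine le_trans ?_ hM
    have : H ≤ 1 / ε := by
      rw [le_div_iff₀ hε]
      rw [le_div_iff₀ (by linarith)] at hεH
      linarith
    calc Real.log R * (2304 * d * H ^ 3) = 2304 * d * H ^ 2 * H * Real.log R := by ring
      _ ≤ 2304 * d * H ^ 2 * (1 / ε) * Real.log R := by gcongr
      _ = _ := by ring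
  have h2 : Real.exp (-(M / (2304 * d * H ^ 3))) ≤ 1 / R := by
    calc _ ≤ Real.exp (-Real.log R) := by gcongr
      _ = 1 / R := by rw [Real.exp_neg, Real.exp_log (by linarith), one_div]
  rw [e]
  calc K * n * (2 * Real.exp (-(M / (2304 * d * H ^ 3))))
      ≤ K * u * (2 * (1 / R)) := by gcongr
    _ = (c₀ - 5) * δ / c₀ ^ 2 := by
        rw [hR]
        field_simp
    _ ≤ 3 * δ / c₀ := by
        rw [div_le_div_iff₀ (by positivity) (by positivity)]
        have : (c₀ - 5) * (δ * c₀) ≤ (3 * c₀) * (δ * c₀) := by gcongr; linarith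
        linarith

theorem coreBound_le {d : ℕ} {D : ℝ} (hd : 1 ≤ d) (hD : Real.log d ≤ D) (hD0 : 0 ≤ D) :
    coreBound d ≤ 40 * d * (1 + D) := by
  have d1 : (1 : ℝ) ≤ d := by exact_mod_cast hd
  have h1 : Real.log (d + 4) ≤ 4 + D := by
    calc Real.log (d + 4) ≤ Real.log (5 * d) := Real.log_le_log (by positivity) (by linarith)
      _ = Real.log 5 + Real.log d := Real.log_mul (by norm_num) (by positivity)
      _ ≤ _ := by
        have := Real.log_le_sub_one_of_pos (show (0 : ℝ) < 5 by norm_num)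
        linarith
  have h2 : Real.log (Real.log (d + 4)) ≤ 3 + D := by
    have h3 := Real.log_le_sub_one_of_pos (Real.log_pos (show (1 : ℝ) < d + 4 by linarith))
    linarith
  have h4 : 4 * d * Real.log (Real.log (d + 4)) ≤ 4 * d * (3 + D) := by gcongr
  have h5 : 0 ≤ d * D := by positivity
  unfold coreBound
  nlinarith

theorem numIterations_le {k : ℕ} {H D : ℝ} (hH : 1 ≤ H) (hD : Real.log H ≤ D) (hD0 : 0 ≤ D)
    (hk : k ≤ 3 * H * Real.log (7 * H) + 1) : ((k + 1 : ℕ) : ℝ) ≤ 20 * H * (1 + D) := by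
  have h1 : Real.log (7 * H) ≤ 6 + D := by
    rw [Real.log_mul (by norm_num) (by positivity)]
    have := Real.log_le_sub_one_of_pos (show (0 : ℝ) < 7 by norm_num)
    linarith
  have h2 : 3 * H * Real.log (7 * H) ≤ 3 * H * (6 + D) := by gcongr
  have h3 : 0 ≤ H * D := by positivity
  push_cast
  nlinarith

/-- The number of samples, with `D = log (d H)`: the factors `u ≤ 40 d (1 + D)` and
`K ≤ 20 H (1 + D)` enter the logarithm in `M` only through `log (u K) = O(1 + D)`. -/
theorem totalSamples_le {c₀ u d H ε δ D : ℝ} {K : ℕ} (h6 : 6 ≤ c₀) (h8 : c₀ ≤ 8) (hK : 1 ≤ K)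
    (hu : 28 ≤ u) (hd : 1 ≤ d) (hH : 1 ≤ H) (hε : 0 < ε) (hεH : ε ≤ 1 / H) (hδ : 0 < δ)
    (hδ1 : δ < 1) (hD : D = Real.log (d * H)) (huD : u ≤ 40 * d * (1 + D))
    (hKD : K ≤ 20 * H * (1 + D)) :
    u * K * ⌈2304 * d * H ^ 2 / ε * Real.log (2 * c₀ ^ 2 * u * K / ((c₀ - 5) * δ))⌉₊
      ≤ 31335200 * (d ^ 2 * H ^ 3 / ε) * (1 + Real.log (1 / δ)) * (1 + D) ^ 3 := by
  have K1 : (1 : ℝ) ≤ K := by exact_mod_cast hK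
  have c5 : 0 < c₀ - 5 := by linarith
  have dH1 : 1 ≤ d * H := one_le_mul_of_one_le_of_one_le hd hH
  have D0 : 0 ≤ D := hD ▸ Real.log_nonneg dH1
  have S0 : 0 ≤ Real.log (1 / δ) := Real.log_nonneg (by rw [le_div_iff₀ hδ]; linarith)
  set N := 1 + D with hN
  have N1 : 1 ≤ N := by linarith
  set S := 1 + Real.log (1 / δ) with hS
  have S1 : 1 ≤ S := by linarith
  set R := 2 * c₀ ^ 2 * u * K / ((c₀ - 5) * δ) with hR
  have R1 : 1 ≤ R := by
    rw [hR, le_div_iff₀ (by positivity)]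
    have a1 : (c₀ - 5) * δ ≤ 3 * 1 := by gcongr; linarith
    have a2 : (2 * 6 ^ 2 * 28 * 1 : ℝ) ≤ 2 * c₀ ^ 2 * u * K := by gcongr
    linarith
  have L0 := Real.log_nonneg R1
  have hRle : R ≤ 2 ^ 17 * (d * H) * N ^ 2 * (1 / δ) := by
    calc R ≤ 2 * 8 ^ 2 * (40 * d * N) * (20 * H * N) / (1 * δ) := by
          rw [hR]
          gcongr
          linarith
      _ = 102400 * (d * H * N ^ 2 * (1 / δ)) := by
          field_simp
          ring
      _ ≤ 2 ^ 17 * (d * H * N ^ 2 * (1 / δ)) := by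
          gcongr
          norm_num
      _ = _ := by ring
  have hL : Real.log R ≤ 17 * N * S := by
    have h1 := Real.log_le_log (by linarith) hRle
    rw [Real.log_mul (by positivity) (by positivity), Real.log_mul (by positivity) (by positivity),
      Real.log_mul (by positivity) (by positivity), Real.log_pow, Real.log_pow, ← hD] at h1
    push_cast at h1
    have h2 := Real.log_le_sub_one_of_pos (show (0 : ℝ) < 2 by norm_num)
    have h3 := Real.log_le_sub_one_of_pos (show 0 < N by linarith)
    nlinarith [mul_nonneg D0 S0]
  have hM : (⌈2304 * d * H ^ 2 / ε * Real.log R⌉₊ : ℝ) ≤ 39169 * (d * H ^ 2 / ε) * N * S := by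
    have h1 := (Nat.ceil_lt_add_one (a := 2304 * d * H ^ 2 / ε * Real.log R) (by positivity)).le
    have h2 : 2304 * d * H ^ 2 / ε * Real.log R ≤ 2304 * d * H ^ 2 / ε * (17 * N * S) := by
      gcongr
    have ε1 : ε ≤ 1 := hεH.trans (by rw [div_le_one (by linarith)]; exact hH)
    have h3 : 1 ≤ d * H ^ 2 / ε := by
      rw [le_div_iff₀ hε]
      have : 1 ≤ d * H ^ 2 := one_le_mul_of_one_le_of_one_le hd (one_le_pow₀ hH)
      linarith
    have h4 : 1 ≤ d * H ^ 2 / ε * N * S :=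
      one_le_mul_of_one_le_of_one_le (one_le_mul_of_one_le_of_one_le h3 N1) S1
    calc _ ≤ _ := h1
      _ ≤ 2304 * d * H ^ 2 / ε * (17 * N * S) + d * H ^ 2 / ε * N * S := add_le_add h2 h4
      _ = _ := by ring
  calc u * K * ⌈2304 * d * H ^ 2 / ε * Real.log R⌉₊
      ≤ (40 * d * N) * (20 * H * N) * (39169 * (d * H ^ 2 / ε) * N * S) := by gcongr
    _ = _ := by ring

end Parameters

section Nondegeneracy

variable {X A : Type*} [MeasurableSpace X] [MeasurableSpace A] {d : ℕ}

theorem LinearMDP.IsWeightedOptimalDesign.nonempty {m : LinearMDP X A d} {f : X × A → ℝ}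
    {ρ : (X × A) →₀ ℝ} (hρ : m.IsWeightedOptimalDesign f ρ) : Nonempty (X × A) := by
  by_contra h
  rw [not_nonempty_iff] at h
  have h1 := hρ.isDesign.sum_eq_one
  rw [Finset.eq_empty_of_isEmpty ρ.support, Finset.sum_empty] at h1
  exact zero_ne_one h1

/-- In dimension zero all transition probabilities would vanish. -/
theorem LinearMDP.one_le_dim (m : LinearMDP X A d) (z : X × A) : 1 ≤ d := by
  obtain ⟨μ, hμ⟩ := m.transition_linear
  rw [Nat.one_le_iff_ne_zero]
  rintro rfl
  have h := hμ z Set.univ MeasurableSet.univ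
  simp at h

end Nondegeneracy

end WLSMDVI

theorem mainTheorem3 (c₀ : ℝ) (hc₀ : c₀ ∈ Set.Icc (6 : ℝ) 8) :
    ∃ c₃ c₄ : ℝ, 1 ≤ c₃ ∧ 1 ≤ c₄ ∧ ∃ (C : ℝ) (p : ℕ),
      ∀ (X A : Type*) [MeasurableSpace X] [MeasurableSpace A] [DiscreteMeasurableSpace A]
        [Fintype A] [Nonempty A] (d : ℕ) (m : WLSMDVI.LinearMDP X A d) (ε δ : ℝ),
        0 < ε → ε ≤ 1 / m.H → 0 < δ → δ < 1 →
        ∀ ρ : (X × A) →₀ ℝ, m.IsWeightedOptimalDesign (fun _ => 1) ρ →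
        ∀ K M : ℕ, K = WLSMDVI.numIterations c₃ m.γ m.H →
          M = WLSMDVI.numRepetitions c₀ c₄ d m.H ε δ K →
          -- the failure probability is at most `3 δ / c₀`
          m.sampleLaw K M ρ.support
              {y | ¬ ∀ x, |m.optimalValue x - m.wlsMDVI m.γ (fun _ => 1) ρ K M y x|
                ≤ 1 / 2 * √m.H}
            ≤ ENNReal.ofReal (3 * δ / c₀) ∧
          -- the number of samples
          (WLSMDVI.sampleCount K M ρ.support : ℝ) ≤ WLSMDVI.coreBound d * K * M ∧
          WLSMDVI.coreBound d * K * M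
            ≤ C * (d ^ 2 * m.H ^ 3 / ε) * (1 + Real.log (1 / δ)) * (1 + Real.log (d * m.H)) ^ p := by
  obtain ⟨h6, h8⟩ := hc₀
  refine ⟨7, 2304, by norm_num, by norm_num, 31335200, 3, ?_⟩
  intro X A _ _ _ _ _ d m ε δ hε hεH hδ hδ1 ρ hρ K M hK hM
  obtain ⟨z⟩ := hρ.nonempty
  have d1 : (1 : ℝ) ≤ d := by exact_mod_cast m.one_le_dim z
  have H1 := m.one_le_H
  have H0 : 0 < m.H := by linarith
  have u28 := WLSMDVI.coreBound_ge (d := d)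
  obtain ⟨k, hk, hk1, hk2⟩ := WLSMDVI.exists_numIterations_eq (g := m.γ) (H := m.H) rfl H1
  rw [hk] at hK
  subst hK
  rw [WLSMDVI.numRepetitions] at hM
  have M0 : 0 < M := by
    rw [hM]
    refine Nat.ceil_pos.2 (mul_pos (by positivity) (Real.log_pos ?_))
    have c5 : 0 < c₀ - 5 := by linarith
    have K1 : (1 : ℝ) ≤ (k + 1 : ℕ) := by exact_mod_cast Nat.le_add_left 1 k
    rw [lt_div_iff₀ (by positivity)]
    have a1 : (c₀ - 5) * δ ≤ 3 * 1 := by gcongr; linarith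
    have a2 : (2 * 6 ^ 2 * 28 * 1 : ℝ)
        ≤ 2 * c₀ ^ 2 * WLSMDVI.coreBound d * (k + 1 : ℕ) := by gcongr
    linarith
  refine ⟨?_, ?_, ?_⟩
  · -- this tolerance makes the error `E = t √(2 d)` of a pass equal to `1 / (12 √H)`, so that
    -- the accumulated error `3 H E` is `√H / 4`
    set t := 1 / (12 * √m.H * √(2 * d)) with ht
    have sH : 1 ≤ √m.H := Real.one_le_sqrt.2 H1
    have sd : 0 < √(2 * (d : ℝ)) := Real.sqrt_pos.2 (by linarith)
    have hE : t * √(2 * d) = 1 / (12 * √m.H) := by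
      rw [ht]
      field_simp
    have hE1 : t * √(2 * d) ≤ 1 := by
      rw [hE, div_le_one (by positivity)]
      linarith
    have acc : m.γ ^ k * (m.H + 2 * k + 1) + 3 * (m.H * (t * √(2 * d))) ≤ 1 / 2 * √m.H := by
      have h1 := WLSMDVI.pow_mul_le_of_le (H := m.H) m.γ_nonneg m.γ_lt_one rfl hk1 hk2
      have h2 : 3 * (m.H * (1 / (12 * √m.H))) = √m.H / 4 := by
        have := Real.mul_self_sqrt H0.le
        field_simp
        linarith
      rw [hE, h2]
      linarith
    refine (measure_mono ?_).trans
      ((m.measure_not_accurate_le hρ M0 z.1 (by positivity : 0 ≤ t) hE1).trans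
        (ENNReal.ofReal_le_ofReal ?_))
    · exact fun y hy hbound => hy fun x => (hbound x).trans acc
    exact WLSMDVI.union_bound_le h6 h8 (Nat.le_add_left 1 k) u28 hρ.card_le d1 H1 hε hεH hδ hδ1
      ((Nat.le_ceil _).trans_eq (by rw [hM]))
  · have e : WLSMDVI.sampleCount (k + 1) M ρ.support = (k + 1) * (M * ρ.support.card) := by
      simp [WLSMDVI.sampleCount, WLSMDVI.Call]
    rw [e]
    have h := mul_le_mul_of_nonneg_left hρ.card_le
      (by positivity : (0 : ℝ) ≤ ((k + 1 : ℕ) : ℝ) * M)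
    push_cast at h ⊢
    linarith
  · have ld : Real.log d ≤ Real.log (d * m.H) :=
      Real.log_le_log (by linarith) (le_mul_of_one_le_right (by linarith) H1)
    have lH : Real.log m.H ≤ Real.log (d * m.H) :=
      Real.log_le_log H0 (le_mul_of_one_le_left H0.le d1)
    have l0 : 0 ≤ Real.log (d * m.H) := (Real.log_nonneg d1).trans ld
    rw [hM]
    exact WLSMDVI.totalSamples_le h6 h8 (Nat.le_add_left 1 k) u28 d1 H1 hε hεH hδ hδ1 rfl
      (WLSMDVI.coreBound_le (m.one_le_dim z) ld l0) (WLSMDVI.numIterations_le H1 lH l0 hk2)
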